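/- Let $p$ be a prime, let $\sigma, b > 0$ be real, let $|\cdot|$ be the absolute value on $\mathbb{Q}_p$, let $\mu$ be the Haar measure on $\mathbb{Q}_p$ with $\mu(\mathbb{Z}_p)=1$, and for $k\in\mathbb{Z}$, $x \in \mathbb{Q}_p$ put $B_k(x)=\{z\in\mathbb{Q}_p : |z-x|\le p^k\}$ and $B_k=B_k(0)$. Let $\chi(x)=e^{2\pi i\{x\}}$, where $\{x\}$ is the fractional part of $x\in\mathbb{Q}_p$, and for $t>0$ let \[\rho(t,x)=\int_{\mathbb{Q}_p}\chi(xy)\,e^{-\sigma t|y|^b}\,d\mu(y),\] the fundamental solution of the diffusion equation $\frac{df}{dt}=-\sigma\Delta f$, where $\Delta$ is the Vladimirov operator with exponent $b$. Let $I$ be a time interval ($I=[0,\infty)$, or $I=[0,T]$ for some $T>0$), let $D(I:\mathbb{Q}_p)$ be the space of càdlàg paths $\omega\colon I\to\mathbb{Q}_p$ with the $\sigma$-algebra generated by the cylinder sets, let $X_t(\omega)=\omega(t)$, and let $P$ be the law on $D(I:\mathbb{Q}_p)$ of the $p$-adic Brownian motion started at $0$: the probability measure such that, for all $0<t_1<\dots<t_k$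 in $I$ and all Borel sets $U_0,\dots,U_k\subseteq\mathbb{Q}_p$, $P(X_0\in U_0, X_{t_1}\in U_1,\dots,X_{t_k}\in U_k)$ equals \[\int_{U_1}\cdots\int_{U_k}\rho(t_1,x_1)\,\rho(t_2-t_1,x_2-x_1)\cdots\rho(t_k-t_{k-1},x_k-x_{k-1})\,d\mu(x_k)\cdots d\mu(x_1)\] if $0\in U_0$, and equals $0$ otherwise. Put $\|X\|_t=\sup_{0\le s\le t}|X_s|$. Let $a\in\mathbb{Z}$ and let $t\in I$ with $t>0$. For all $y\in B_a$, if $n$ is a positive integer large enough that $B_{-n}(y)\subseteq B_a$, then \[P\big(\|X\|_t\le p^a \,\big|\, X_t\in B_{-n}(y)\big) > P\big(\|X\|_t\le p^a\big).\] -/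

import Mathlib

open MeasureTheory Set Filter Topology
open scoped ENNReal ProbabilityTheory

noncomputable section

namespace PadicBrownian

/-! ### The field of `p`-adic numbers: balls, Haar measure, the character `χ` -/

section Padic

variable (p : ℕ) [Fact p.Prime]

/-- `ℚ_[p]` carries its Borel `σ`-algebra. -/
instance instMeasurableSpacePadic : MeasurableSpace ℚ_[p] := borel ℚ_[p]

instance instBorelSpacePadic : BorelSpace ℚ_[p] := ⟨rfl⟩

/-- The ball `B_k(x) = {y : |y - x| ≤ p ^ k}`, for an integer `k`. -/
def ball (k : ℤ) (x : ℚ_[p]) : Set ℚ_[p] := {y | ‖y - x‖ ≤ (p : ℝ) ^ k}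

/-- The ring of integers `ℤ_p`, the closed unit ball, as a compact set with nonempty interior. -/
def unitBall : TopologicalSpace.PositiveCompacts ℚ_[p] where
  carrier := Metric.closedBall 0 1
  isCompact' := isCompact_closedBall 0 1
  interior_nonempty' :=
    ⟨0, Metric.ball_subset_interior_closedBall (Metric.mem_ball_self one_pos)⟩

/-- The Haar measure on the additive group `ℚ_[p]`, normalized to be `1` on `ℤ_p`. -/
def haar : Measure ℚ_[p] := Measure.addHaarMeasure (unitBall p)

variable {p}

/-- The least natural number `k` with `p ^ k * x ∈ ℤ_p`, that is `max 0 (-v_p(x))`. -/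
def poleOrder (x : ℚ_[p]) : ℕ := (-x.valuation).toNat

theorem norm_pow_poleOrder_mul_le (x : ℚ_[p]) : ‖(p : ℚ_[p]) ^ poleOrder x * x‖ ≤ 1 := by
  have hp : (1 : ℝ) < p := by exact_mod_cast (Fact.out : p.Prime).one_lt
  rcases eq_or_ne x 0 with rfl | hx
  · simp
  · rw [norm_mul, ← zpow_natCast, Padic.norm_p_zpow, Padic.norm_eq_zpow_neg_valuation hx,
      ← zpow_add₀ (by positivity)]
    refine zpow_le_one_of_nonpos₀ hp.le ?_
    have := Int.self_le_toNat (-x.valuation)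
    simp only [poleOrder]
    omega

/-- The fractional part `{x} = ∑_{k < 0} a_x(k) p ^ k` of `x = ∑_k a_x(k) p ^ k`, with digits
`a_x(k) ∈ {0, …, p - 1}`.  With `m = poleOrder x`, the natural number
`PadicInt.appr (p ^ m * x) m` is the truncated expansion `∑_{-m ≤ k < 0} a_x(k) p ^ (k + m)`. -/
def fractionalPart (x : ℚ_[p]) : ℚ :=
  (PadicInt.appr (⟨(p : ℚ_[p]) ^ poleOrder x * x, norm_pow_poleOrder_mul_le x⟩ : ℤ_[p])
    (poleOrder x) : ℚ) / (p : ℚ) ^ poleOrder x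

/-- The rank `0` character `χ(x) = exp (2πi {x})` of `ℚ_[p]`. -/
def chi (x : ℚ_[p]) : ℂ :=
  Complex.exp (2 * Real.pi * Complex.I * ((fractionalPart x : ℚ) : ℂ))

/-- The inverse Fourier transform `(𝓕⁻¹ f)(y) = ∫ χ(x y) f(x) dμ(x)` of an integrable `f`. -/
def invFourier (f : ℚ_[p] → ℂ) (y : ℚ_[p]) : ℂ := ∫ x, chi (x * y) * f x ∂(haar p)

/-- `ρ(t, x) = (𝓕⁻¹ exp (-σ t |·| ^ b)) (x)`, the fundamental solution of the diffusion equation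
`df/dt = -σ Δ f`, where `Δ` is the Vladimirov operator with exponent `b`. -/
def rho (σ b t : ℝ) (x : ℚ_[p]) : ℂ :=
  invFourier (fun y : ℚ_[p] => (Real.exp (-σ * t * ‖y‖ ^ b) : ℂ)) x

end Padic

/-! ### Path spaces -/

/-- A time interval: either `[0, ∞)` or `[0, T]` for some positive `T`. -/
structure TimeInterval where
  carrier : Set ℝ
  isInterval : carrier = Ici 0 ∨ ∃ T : ℝ, 0 < T ∧ carrier = Icc 0 T

/-- The initial time. -/
def TimeInterval.zero (I : TimeInterval) : I.carrier :=
  ⟨0, by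
    rcases I.isInterval with h | ⟨T, hT, h⟩
    · simp [h]
    · simp [h, hT.le]⟩

/-- A path is càdlàg if it is right continuous with left limits at every time. -/
def IsCadlag {I : TimeInterval} {S : Type*} [TopologicalSpace S] (ω : I.carrier → S) : Prop :=
  ∀ t, ContinuousWithinAt ω (Ici t) t ∧ ∃ l, Tendsto ω (𝓝[<] t) (𝓝 l)

/-- The set `D(I : S)` of Skorohod paths, i.e. of càdlàg functions from `I` to `S`. -/
def SkorohodSpace (I : TimeInterval) (S : Type*) [TopologicalSpace S] : Type _ :=
  {ω : I.carrier → S // IsCadlag ω}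

section SkorohodSpace

variable {I : TimeInterval} {S : Type*} [TopologicalSpace S]

/-- The canonical process `X_t(ω) = ω(t)`. -/
def X (t : I.carrier) (ω : SkorohodSpace I S) : S := ω.1 t

/-- The `σ`-algebra generated by the cylinder sets. -/
instance instMeasurableSpaceSkorohod [MeasurableSpace S] : MeasurableSpace (SkorohodSpace I S) :=
  ⨆ t : I.carrier, MeasurableSpace.comap (X t) inferInstance

/-- `‖X‖_t = sup_{0 ≤ s ≤ t} |X_s|`, as an extended nonnegative real. -/
def supNorm {p : ℕ} [Fact p.Prime] (t : I.carrier) (ω : SkorohodSpace I ℚ_[p]) : ℝ≥0∞ :=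
  ⨆ s : I.carrier, ⨆ _ : s ≤ t, ‖X s ω‖ₑ

end SkorohodSpace

/-- A history: an epoch `0 < t_1 < ⋯ < t_k` in `I` and a route `U_0, U_1, …, U_k` of measurable
sets. -/
structure History (I : TimeInterval) (S : Type*) [MeasurableSpace S] where
  length : ℕ
  epoch : Fin length → I.carrier
  epoch_pos : ∀ i, 0 < (epoch i : ℝ)
  epoch_strictMono : StrictMono epoch
  route : Fin (length + 1) → Set S
  measurableSet_route : ∀ i, MeasurableSet (route i)

/-- The simple cylinder set `C(h) = {ω : ω(0) ∈ U_0, ω(t_1) ∈ U_1, …, ω(t_k) ∈ U_k}`. -/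
def History.cylinder {I : TimeInterval} {S : Type*} [TopologicalSpace S] [MeasurableSpace S]
    (h : History I S) : Set (SkorohodSpace I S) :=
  {ω | X I.zero ω ∈ h.route 0 ∧ ∀ i : Fin h.length, X (h.epoch i) ω ∈ h.route i.succ}

/-! ### Brownian motion on `ℚ_[p]` -/

section BrownianMotion

variable {p : ℕ} [Fact p.Prime]

/-- `iterInt σ b k s x e U` is the iterated integral
`∫_{U_1} ⋯ ∫_{U_k} ρ(e_1 - s, x_1 - x) ρ(e_2 - e_1, x_2 - x_1) ⋯ ρ(e_k - e_{k-1}, x_k - x_{k-1})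
dμ(x_k) ⋯ dμ(x_1)`.  The values of `ρ` are nonnegative reals. -/
def iterInt (σ b : ℝ) : (k : ℕ) → ℝ → ℚ_[p] → (Fin k → ℝ) → (Fin k → Set ℚ_[p]) → ℝ≥0∞
  | 0, _, _, _, _ => 1
  | k + 1, s, x, e, U =>
    ∫⁻ z in U 0, ENNReal.ofReal (rho σ b (e 0 - s) (z - x)).re *
      iterInt σ b k (e 0) z (Fin.tail e) (Fin.tail U) ∂(haar p)

open Classical in
/-- `P` is the law on `D(I : ℚ_[p])` of the Brownian motion started at `0` with diffusion constant
`σ` and exponent `b`: the probability measure whose values on the simple cylinder sets are given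
by the transition density `ρ`. -/
structure IsBrownianLaw (σ b : ℝ) {I : TimeInterval} (P : Measure (SkorohodSpace I ℚ_[p])) :
    Prop where
  isProbabilityMeasure : IsProbabilityMeasure P
  cylinder_apply : ∀ h : History I ℚ_[p], P h.cylinder =
    if (0 : ℚ_[p]) ∈ h.route 0 then
      iterInt σ b h.length 0 0 (fun i => (h.epoch i : ℝ)) (fun i => h.route i.succ)
    else 0

end BrownianMotion

end PadicBrownian

end

/-! Write `A` for the event of staying in B_a up to time t, `W` for X_t ∈ U with U = B_{-n}(y), and
μ for Haar measure. The density ρ(t, ·) is radial, so a path that is outside B_a at some moment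
returns with a density that is constant on B_a. Hence the paths that leave B_a and end in U
contribute μ(U) times a constant independent of U. Comparing U with B_a itself eliminates the
constant: P(A ∩ W) = P(W) - (μ(U)/μ(B_a)) (M - P(A)), where M = P(X_t ∈ B_a). On finite grids this
is `exists_iterInt_add_eq` and `measure_gridStays_inter`; right continuity carries it to the
supremum in `measure_supNorm_le_inter`.

Let c be the mean of |y|^b over B_{-a}, let C = (p^{1-a})^b and E = exp(-σtC). Since ρ(t, ·) ≥ (M -
E)/μ(B_a) on B_a (`rhoProfile_le_re_rho`, `rhoProfile_eq`), the claim follows from E < P(A)(1 - M +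
E). By Fourier inversion M is the mean of exp(-σt|y|^b) over B_{-a}. Jensen's inequality on every
grid gives P(A) ≥ exp(-σtc), the chord of exp gives M ≤ 1 - (c/C)(1 - E), and strict convexity of
exp closes the gap because c < C. -/

namespace PadicBrownian

/-! ### The additive character of ℚ_p -/

section Character

variable {p : ℕ} [Fact p.Prime]

theorem one_lt_cast_prime (p : ℕ) [Fact p.Prime] : (1 : ℝ) < p := by
  exact_mod_cast (Fact.out : p.Prime).one_lt

theorem exists_int_eq_of_norm_le_one (N : ℤ) (m : ℕ)
    (h : ‖((N / (p : ℚ) ^ m : ℚ) : ℚ_[p])‖ ≤ 1) : ∃ k : ℤ, (N / (p : ℚ) ^ m : ℚ) = k := by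
  have hp := one_lt_cast_prime p
  have hp0 : (p : ℚ) ≠ 0 := by exact_mod_cast (Fact.out : p.Prime).ne_zero
  have h2 : ‖(N : ℚ_[p])‖ ≤ (p : ℝ) ^ (-m : ℤ) := by
    push_cast at h
    rw [norm_div, norm_pow, Padic.norm_p, div_le_one (by positivity)] at h
    simpa using h
  obtain ⟨k, rfl⟩ := (Padic.norm_int_le_pow_iff_dvd N m).1 h2
  refine ⟨k, ?_⟩
  push_cast
  field_simp

theorem exists_fractionalPart_eq (x : ℚ_[p]) :
    ∃ (N : ℤ) (m : ℕ), fractionalPart x = N / (p : ℚ) ^ m ∧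
      ‖x - ((fractionalPart x : ℚ) : ℚ_[p])‖ ≤ 1 := by
  have hp := one_lt_cast_prime p
  have hp0 : (p : ℚ_[p]) ≠ 0 := by exact_mod_cast (Fact.out : p.Prime).ne_zero
  set m := poleOrder x with hm
  set z : ℤ_[p] := ⟨(p : ℚ_[p]) ^ m * x, norm_pow_poleOrder_mul_le x⟩ with hz
  refine ⟨(z.appr m : ℤ), m, by rw [fractionalPart, Int.cast_natCast], ?_⟩
  have h1 := ((z - z.appr m).norm_le_pow_iff_mem_span_pow m).2 (z.appr_spec m)
  have h2 : ‖(p : ℚ_[p]) ^ m * x - (z.appr m : ℚ_[p])‖ ≤ (p : ℝ) ^ (-m : ℤ) := by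
    rwa [PadicInt.norm_def, PadicInt.coe_sub, PadicInt.coe_natCast] at h1
  have h3 : x - ((fractionalPart x : ℚ) : ℚ_[p])
      = ((p : ℚ_[p]) ^ m * x - (z.appr m : ℚ_[p])) / (p : ℚ_[p]) ^ m := by
    rw [show fractionalPart x = (z.appr m : ℚ) / (p : ℚ) ^ m from rfl]
    push_cast
    field_simp
  rw [h3, norm_div, norm_pow, Padic.norm_p, div_le_one (by positivity)]
  simpa using h2

/-- Two rationals with p-power denominators that are congruent to x modulo ℤ_p differ by an integer,
so the fractional part may be replaced by any of them. Additivity and the value at p⁻¹ both follow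
from this. -/
theorem chi_eq_exp (x : ℚ_[p]) (N : ℤ) (m : ℕ)
    (h : ‖x - ((N / (p : ℚ) ^ m : ℚ) : ℚ_[p])‖ ≤ 1) :
    chi x = Complex.exp (2 * Real.pi * Complex.I * ((N / (p : ℚ) ^ m : ℚ) : ℂ)) := by
  have hp0 : (p : ℚ) ≠ 0 := by exact_mod_cast (Fact.out : p.Prime).ne_zero
  obtain ⟨N', m', h1, h2⟩ := exists_fractionalPart_eq x
  have h3 : fractionalPart x - N / (p : ℚ) ^ m
      = ((N' * p ^ m - N * p ^ m' : ℤ) : ℚ) / (p : ℚ) ^ (m' + m) := by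
    rw [h1]; push_cast; field_simp; ring
  have h4 : ‖((fractionalPart x - N / (p : ℚ) ^ m : ℚ) : ℚ_[p])‖ ≤ 1 := by
    have : ((fractionalPart x - N / (p : ℚ) ^ m : ℚ) : ℚ_[p])
        = (x - ((N / (p : ℚ) ^ m : ℚ) : ℚ_[p])) - (x - ((fractionalPart x : ℚ) : ℚ_[p])) := by
      push_cast; ring
    rw [this, sub_eq_add_neg]
    exact (Padic.nonarchimedean _ _).trans (max_le h (by rwa [norm_neg]))
  rw [h3] at h4
  obtain ⟨k, hk⟩ := exists_int_eq_of_norm_le_one _ _ h4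
  rw [← h3] at hk
  have h5 : (2 * Real.pi * Complex.I * ((fractionalPart x : ℚ) : ℂ))
      = 2 * Real.pi * Complex.I * ((N / (p : ℚ) ^ m : ℚ) : ℂ) + k * (2 * Real.pi * Complex.I) := by
    have : fractionalPart x = N / (p : ℚ) ^ m + k := by linarith
    rw [this]; push_cast; ring
  rw [chi, h5, Complex.exp_add, Complex.exp_int_mul_two_pi_mul_I, mul_one]

theorem chi_add (x y : ℚ_[p]) : chi (x + y) = chi x * chi y := by
  have hp0 : (p : ℚ) ≠ 0 := by exact_mod_cast (Fact.out : p.Prime).ne_zero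
  obtain ⟨N, m, h1, h2⟩ := exists_fractionalPart_eq x
  obtain ⟨N', m', h1', h2'⟩ := exists_fractionalPart_eq y
  have h3 : fractionalPart x + fractionalPart y
      = ((N * p ^ m' + N' * p ^ m : ℤ) : ℚ) / (p : ℚ) ^ (m + m') := by
    rw [h1, h1']; push_cast; field_simp; ring
  rw [chi_eq_exp (x + y) (N * p ^ m' + N' * p ^ m) (m + m'), ← h3, chi, chi, ← Complex.exp_add]
  · push_cast; ring_nf
  · rw [← h3]
    have : x + y - ((fractionalPart x + fractionalPart y : ℚ) : ℚ_[p])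
        = (x - ((fractionalPart x : ℚ) : ℚ_[p])) + (y - ((fractionalPart y : ℚ) : ℚ_[p])) := by
      push_cast; ring
    rw [this]
    exact (Padic.nonarchimedean _ _).trans (max_le h2 h2')

theorem chi_of_norm_le_one {x : ℚ_[p]} (hx : ‖x‖ ≤ 1) : chi x = 1 := by
  simpa using chi_eq_exp x 0 0 (by simpa using hx)

theorem norm_chi (x : ℚ_[p]) : ‖chi x‖ = 1 := by
  rw [chi]
  have : (2 * Real.pi * Complex.I * ((fractionalPart x : ℚ) : ℂ))
      = ((2 * Real.pi * (fractionalPart x : ℚ) : ℝ) : ℂ) * Complex.I := by push_cast; ring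
  rw [this, Complex.norm_exp_ofReal_mul_I]

theorem chi_inv_prime_ne_one : chi ((p : ℚ_[p])⁻¹) ≠ 1 := by
  have hp := one_lt_cast_prime p
  have hp0 : (p : ℂ) ≠ 0 := by exact_mod_cast (Fact.out : p.Prime).ne_zero
  rw [chi_eq_exp _ 1 1 (by simp), Ne, Complex.exp_eq_one_iff]
  rintro ⟨n, hn⟩
  have h1 : (2 * Real.pi * Complex.I) ≠ 0 := Complex.two_pi_I_ne_zero
  have h2 : ((p : ℂ))⁻¹ = n := by
    have := mul_left_cancel₀ h1 (hn.trans (mul_comm _ _))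
    simpa using this
  have h3 : (1 : ℂ) = n * p := by rw [← h2, inv_mul_cancel₀ hp0]
  have h4 : (1 : ℤ) = n * p := by exact_mod_cast h3
  have h5 : (p : ℤ) ∣ 1 := Dvd.intro_left n h4.symm
  have h6 := Int.le_of_dvd one_pos h5
  have h7 := (Fact.out : p.Prime).one_lt
  omega

theorem continuous_chi : Continuous (chi : ℚ_[p] → ℂ) := by
  refine (IsLocallyConstant.iff_exists_open _).2 (fun x => ?_) |>.continuous
  refine ⟨Metric.ball x 1, Metric.isOpen_ball, Metric.mem_ball_self one_pos, fun y hy => ?_⟩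
  have : y = (y - x) + x := by ring
  rw [this, chi_add, chi_of_norm_le_one, one_mul]
  rw [← dist_eq_norm]
  exact (Metric.mem_ball.1 hy).le

end Character

/-! ### Balls and their Haar measure -/

section Balls

variable {p : ℕ} [Fact p.Prime]

theorem mem_ball {k : ℤ} {x y : ℚ_[p]} : y ∈ ball p k x ↔ ‖y - x‖ ≤ (p : ℝ) ^ k := Iff.rfl

theorem mem_ball_zero {k : ℤ} {y : ℚ_[p]} : y ∈ ball p k 0 ↔ ‖y‖ ≤ (p : ℝ) ^ k := by
  simp [mem_ball]

theorem ball_eq_closedBall (k : ℤ) (x : ℚ_[p]) :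
    ball p k x = Metric.closedBall x ((p : ℝ) ^ k) := by
  ext y
  rw [mem_ball, Metric.mem_closedBall, dist_eq_norm]

theorem zpow_prime_pos (p : ℕ) [Fact p.Prime] (k : ℤ) : (0 : ℝ) < (p : ℝ) ^ k :=
  zpow_pos (zero_lt_one.trans (one_lt_cast_prime p)) k

theorem isCompact_ball (k : ℤ) (x : ℚ_[p]) : IsCompact (ball p k x) := by
  rw [ball_eq_closedBall]; exact isCompact_closedBall _ _

theorem isOpen_ball (k : ℤ) (x : ℚ_[p]) : IsOpen (ball p k x) := by
  rw [ball_eq_closedBall]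
  exact IsUltrametricDist.isOpen_closedBall _ (zpow_prime_pos p k).ne'

theorem isClosed_ball (k : ℤ) (x : ℚ_[p]) : IsClosed (ball p k x) := (isCompact_ball k x).isClosed

theorem measurableSet_ball (k : ℤ) (x : ℚ_[p]) : MeasurableSet (ball p k x) :=
  (isOpen_ball k x).measurableSet

theorem norm_add_eq_of_norm_lt {x y : ℚ_[p]} (h : ‖x‖ < ‖y‖) : ‖x + y‖ = ‖y‖ := by
  rw [Padic.add_eq_max_of_ne h.ne, max_eq_right h.le]

theorem add_mem_ball_zero {k : ℤ} {x y : ℚ_[p]} (hx : x ∈ ball p k 0) (hy : y ∈ ball p k 0) :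
    x + y ∈ ball p k 0 := by
  rw [mem_ball_zero] at *
  exact (Padic.nonarchimedean _ _).trans (max_le hx hy)

theorem neg_mem_ball_zero {k : ℤ} {x : ℚ_[p]} (hx : x ∈ ball p k 0) : -x ∈ ball p k 0 := by
  rw [mem_ball_zero] at *
  rwa [norm_neg]

theorem add_mem_ball_zero_iff {k : ℤ} {x y : ℚ_[p]} (hx : x ∈ ball p k 0) :
    y + x ∈ ball p k 0 ↔ y ∈ ball p k 0 := by
  refine ⟨fun h => ?_, fun h => add_mem_ball_zero h hx⟩
  simpa using add_mem_ball_zero h (neg_mem_ball_zero hx)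

instance isAddHaarMeasure_haar : (haar p).IsAddHaarMeasure := by
  unfold haar; infer_instance

theorem haar_ball_lt_top (k : ℤ) (x : ℚ_[p]) : haar p (ball p k x) < ∞ :=
  (isCompact_ball k x).measure_lt_top

theorem haar_ball_pos (k : ℤ) (x : ℚ_[p]) : 0 < haar p (ball p k x) :=
  (isOpen_ball k x).measure_pos _ ⟨x, by simp [mem_ball, (zpow_prime_pos p k).le]⟩

theorem haar_ball_zero_zero : haar p (ball p 0 0) = 1 := by
  have : ball p 0 0 = (unitBall p : Set ℚ_[p]) := by
    rw [ball_eq_closedBall, zpow_zero]; rfl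
  rw [this, haar, Measure.addHaarMeasure_self]

open scoped Pointwise in
/-- The Haar measure of the balls is a geometric progression. -/
theorem exists_haar_ball_eq_zpow (p : ℕ) [Fact p.Prime] :
    ∃ c : NNReal, c ≠ 0 ∧ ∀ k : ℤ, haar p (ball p k 0) = ((c ^ k : NNReal) : ℝ≥0∞) := by
  have hp0 : (p : ℚ_[p]) ≠ 0 := by exact_mod_cast (Fact.out : p.Prime).ne_zero
  -- Multiplication by p⁻¹ carries B_k onto B_{k+1}, so the ratio is its Haar modulus. That the
  -- modulus equals p is never needed.
  set u : ℚ_[p]ˣ := (Units.mk0 (p : ℚ_[p]) hp0)⁻¹ with hu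
  refine ⟨distribHaarChar ℚ_[p] u, distribHaarChar_pos.ne', fun k => ?_⟩
  have h1 := distribHaarChar_mul (A := ℚ_[p]) (haar p) (u ^ k) (ball p 0 0)
  rw [map_zpow, haar_ball_zero_zero, mul_one] at h1
  rw [h1]
  congr 1
  ext x
  rw [Set.mem_smul_set_iff_inv_smul_mem, mem_ball_zero, mem_ball_zero, Units.smul_def,
    smul_eq_mul, norm_mul]
  have h2 : ‖((((u ^ k)⁻¹ : ℚ_[p]ˣ)) : ℚ_[p])‖ = ((p : ℝ) ^ k)⁻¹ := by
    rw [hu, inv_zpow, inv_inv, Units.val_zpow_eq_zpow_val, Units.val_mk0, norm_zpow, Padic.norm_p,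
      inv_zpow]
  rw [h2, inv_mul_le_iff₀ (zpow_prime_pos p k)]
  simp

theorem haar_real_ball_mul_haar_real_ball_neg (k : ℤ) :
    (haar p).real (ball p k 0) * (haar p).real (ball p (-k) 0) = 1 := by
  obtain ⟨c, hc, h⟩ := exists_haar_ball_eq_zpow p
  simp only [Measure.real, h, ENNReal.coe_toReal, NNReal.coe_zpow]
  rw [← zpow_add₀ (by exact_mod_cast hc)]
  simp

end Balls

/-! ### The Fourier multiplier and the radial form of ρ -/

section HeatMultiplier

variable {p : ℕ} [Fact p.Prime]

/-- The Fourier multiplier `exp (-σ t |y| ^ b)` of the diffusion semigroup. -/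
noncomputable def heat (σ b t : ℝ) (y : ℚ_[p]) : ℝ := Real.exp (-σ * t * ‖y‖ ^ b)

/-- A single term of the exponential series, of degree n ≥ M/b, already gives decay of order M. -/
theorem exists_exp_neg_rpow_le {s b : ℝ} (hs : 0 < s) (hb : 0 < b) (M : ℕ) :
    ∃ K : ℝ, 1 ≤ K ∧ ∀ r : ℝ, 1 ≤ r → Real.exp (-(s * r ^ b)) ≤ K * (r ^ M)⁻¹ := by
  obtain ⟨n, hn⟩ := exists_nat_ge (M / b)
  refine ⟨max 1 (n.factorial / s ^ n), le_max_left _ _, fun r hr => ?_⟩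
  have hr0 : 0 < r := zero_lt_one.trans_le hr
  have hu : 0 < r ^ b := Real.rpow_pos_of_pos hr0 b
  have h1 : r ^ M ≤ (r ^ b) ^ n := by
    rw [← Real.rpow_natCast, ← Real.rpow_natCast (r ^ b), ← Real.rpow_mul hr0.le]
    exact Real.rpow_le_rpow_of_exponent_le hr (by rw [div_le_iff₀ hb] at hn; linarith)
  have h2 := Real.pow_div_factorial_le_exp (s * r ^ b) (by positivity) n
  rw [Real.exp_neg]
  calc (Real.exp (s * r ^ b))⁻¹ ≤ ((s * r ^ b) ^ n / n.factorial)⁻¹ :=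
        inv_anti₀ (by positivity) h2
    _ = n.factorial / s ^ n * ((r ^ b) ^ n)⁻¹ := by
        rw [mul_pow]; field_simp
    _ ≤ max 1 (n.factorial / s ^ n) * (r ^ M)⁻¹ := by
        gcongr
        exact le_max_right _ _

theorem continuous_heat {σ b : ℝ} (hb : 0 < b) (t : ℝ) :
    Continuous (heat σ b t : ℚ_[p] → ℝ) := by
  unfold heat
  exact Real.continuous_exp.comp
    (continuous_const.mul (continuous_norm.rpow_const fun _ => Or.inr hb.le))

theorem heat_pos (σ b t : ℝ) (y : ℚ_[p]) : 0 < heat σ b t y := Real.exp_pos _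

theorem exists_norm_eq_zpow {y : ℚ_[p]} (hy : y ≠ 0) : ∃ k : ℤ, ‖y‖ = (p : ℝ) ^ k :=
  ⟨-y.valuation, Padic.norm_eq_zpow_neg_valuation hy⟩

theorem integrable_heat {σ b t : ℝ} (hσ : 0 < σ) (hb : 0 < b) (ht : 0 < t) :
    Integrable (heat σ b t : ℚ_[p] → ℝ) (haar p) := by
  have hp := one_lt_cast_prime p
  have hp0 : (0 : ℝ) < p := zero_lt_one.trans hp
  obtain ⟨c, hc, hball⟩ := exists_haar_ball_eq_zpow p
  -- The decay order M must beat the volume growth c of the balls, so that the dominating series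
  -- over balls is geometric with ratio c / p^M < 1.
  obtain ⟨M, hM⟩ := pow_unbounded_of_one_lt (2 * (c : ℝ)) hp
  obtain ⟨K, hK1, hK⟩ := exists_exp_neg_rpow_le (mul_pos hσ ht) hb M
  have hK0 : 0 < K := zero_lt_one.trans_le hK1
  set q : ℝ := ((p : ℝ) ^ M)⁻¹ with hq
  have hq0 : 0 < q := by positivity
  have hqc : q * c < 1 := by
    rw [hq, inv_mul_lt_iff₀ (by positivity)]
    have : (0 : ℝ) < c := by exact_mod_cast pos_iff_ne_zero.2 hc
    linarith
  refine ⟨(continuous_heat hb t).aestronglyMeasurable, ?_⟩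
  have hle : ∀ y : ℚ_[p], ‖heat σ b t y‖ₑ ≤
      ∑' k : ℕ, ENNReal.ofReal (K * q ^ k) * (ball p (k : ℤ) 0).indicator 1 y := by
    intro y
    rw [Real.enorm_eq_ofReal (heat_pos σ b t y).le]
    obtain ⟨k, hk, hk'⟩ : ∃ k : ℕ, y ∈ ball p (k : ℤ) 0 ∧ heat σ b t y ≤ K * q ^ k := by
      by_cases h1 : ‖y‖ ≤ 1
      · refine ⟨0, by simpa [mem_ball_zero] using h1, ?_⟩
        have : heat σ b t y ≤ 1 := by
          rw [heat, Real.exp_le_one_iff]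
          have : 0 ≤ σ * t * ‖y‖ ^ b := by positivity
          linarith
        simpa using this.trans hK1
      · have hy : y ≠ 0 := by rintro rfl; simp at h1
        obtain ⟨j, hj⟩ := exists_norm_eq_zpow hy
        have hj0 : 0 ≤ j := by
          by_contra! hneg
          exact h1 (hj ▸ zpow_le_one_of_nonpos₀ hp.le hneg.le)
        lift j to ℕ using hj0
        refine ⟨j, mem_ball_zero.2 hj.le, ?_⟩
        have h2 := hK ‖y‖ (not_le.1 h1).le
        have h3 : q ^ j = (‖y‖ ^ M)⁻¹ := by
          rw [hj, zpow_natCast, hq, inv_pow, ← pow_mul, ← pow_mul, mul_comm]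
        rw [h3, heat]
        convert h2 using 2
        ring
    refine le_trans ?_ (ENNReal.le_tsum k)
    rw [indicator_of_mem hk, Pi.one_apply, mul_one]
    exact ENNReal.ofReal_le_ofReal hk'
  rw [HasFiniteIntegral]
  refine (lintegral_mono hle).trans_lt ?_
  rw [lintegral_tsum fun k => ((measurable_one.indicator (measurableSet_ball _ _)).const_mul
    _).aemeasurable]
  have hterm : ∀ k : ℕ, ∫⁻ y, ENNReal.ofReal (K * q ^ k) * (ball p (k : ℤ) 0).indicator 1 y ∂(haar p)
      = ENNReal.ofReal (K * (q * c) ^ k) := by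
    intro k
    rw [lintegral_const_mul _ (measurable_one.indicator (measurableSet_ball _ _)),
      lintegral_indicator_one (measurableSet_ball _ _), hball, zpow_natCast,
      ← ENNReal.ofReal_coe_nnreal, ← ENNReal.ofReal_mul (by positivity), NNReal.coe_pow, mul_pow,
      mul_assoc]
  simp_rw [hterm]
  exact ((summable_geometric_of_lt_one (by positivity) hqc).mul_left K).tsum_ofReal_lt_top

/-- Translation invariance of Haar measure makes the integral equal to z times itself. -/
theorem setIntegral_eq_zero_of_shift {T : Set ℚ_[p]} (hT : MeasurableSet T) (G : ℚ_[p] → ℂ)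
    (u : ℚ_[p]) (z : ℂ) (hz : z ≠ 1)
    (hG : ∀ y, T.indicator G (y + u) = z * T.indicator G y) :
    ∫ y in T, G y ∂(haar p) = 0 := by
  rw [← integral_indicator hT]
  have h1 := integral_add_right_eq_self (μ := haar p) (T.indicator G) u
  simp_rw [hG, integral_const_mul] at h1
  have h2 : (z - 1) * ∫ y, T.indicator G y ∂(haar p) = 0 := by rw [sub_mul, h1]; ring
  exact (mul_eq_zero.1 h2).resolve_left (sub_ne_zero.2 hz)

theorem zpow_le_norm_of_notMem_ball {k : ℤ} {y : ℚ_[p]} (hy : y ∉ ball p k 0) :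
    (p : ℝ) ^ (k + 1) ≤ ‖y‖ := by
  rw [mem_ball_zero, Padic.norm_le_pow_iff_norm_lt_pow_add_one, not_lt] at hy
  exact hy

theorem setIntegral_chi_mul_ball (k : ℤ) {y : ℚ_[p]} (hy : y ∉ ball p (-k) 0) :
    ∫ x in ball p k 0, chi (y * x) ∂(haar p) = 0 := by
  have hp0 : (p : ℝ) ≠ 0 := (zero_lt_one.trans (one_lt_cast_prime p)).ne'
  have hn := zpow_le_norm_of_notMem_ball hy
  have hy0 : y ≠ 0 := by
    rintro rfl
    exact hy (by simpa [mem_ball_zero] using (zpow_prime_pos p (-k)).le)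
  -- Translating x by this element preserves B_k and multiplies χ(yx) by χ(p⁻¹) ≠ 1.
  have hu : (p : ℚ_[p])⁻¹ * y⁻¹ ∈ ball p k 0 := by
    rw [mem_ball_zero, norm_mul, norm_inv, norm_inv, Padic.norm_p, inv_inv,
      mul_inv_le_iff₀ (norm_pos_iff.2 hy0)]
    calc (p : ℝ) = (p : ℝ) ^ k * (p : ℝ) ^ (-k + 1) := by rw [← zpow_add₀ hp0]; simp
      _ ≤ _ := by gcongr
  refine setIntegral_eq_zero_of_shift (measurableSet_ball _ _) _ ((p : ℚ_[p])⁻¹ * y⁻¹) _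
    (chi_inv_prime_ne_one (p := p)) fun x => ?_
  by_cases hx : x ∈ ball p k 0
  · rw [indicator_of_mem hx, indicator_of_mem ((add_mem_ball_zero_iff hu).2 hx), mul_add, chi_add,
      mul_comm]
    congr 2
    field_simp
  · rw [indicator_of_notMem hx, indicator_of_notMem (fun h => hx ((add_mem_ball_zero_iff hu).1 h)),
      mul_zero]

theorem chi_mul_eq_one_of_mem_ball {k : ℤ} {x y : ℚ_[p]} (hx : x ∈ ball p k 0)
    (hy : y ∈ ball p (-k) 0) : chi (y * x) = 1 := by
  rw [mem_ball_zero] at hx hy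
  refine chi_of_norm_le_one ?_
  rw [norm_mul]
  calc ‖y‖ * ‖x‖ ≤ (p : ℝ) ^ (-k) * (p : ℝ) ^ k := by
        gcongr
    _ = 1 := by rw [zpow_neg, inv_mul_cancel₀ (zpow_prime_pos p k).ne']

/-- The value of `ρ(t, ·)` on the sphere of radius `p ^ k`. -/
noncomputable def rhoProfile (p : ℕ) [Fact p.Prime] (σ b t : ℝ) (k : ℤ) : ℝ :=
  ∫ y in ball p (-k) 0, (heat σ b t y - Real.exp (-σ * t * ((p : ℝ) ^ (1 - k)) ^ b)) ∂(haar p)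

theorem integrable_chi_mul_heat {σ b t : ℝ} (hσ : 0 < σ) (hb : 0 < b) (ht : 0 < t) (x : ℚ_[p]) :
    Integrable (fun y : ℚ_[p] => chi (y * x) * (heat σ b t y : ℂ)) (haar p) := by
  refine (integrable_heat hσ hb ht).mono ?_ (ae_of_all _ fun y => ?_)
  · exact ((continuous_chi.comp (continuous_id.mul continuous_const)).mul
      (Complex.continuous_ofReal.comp (continuous_heat hb t))).aestronglyMeasurable
  · rw [norm_mul, norm_chi, one_mul, Complex.norm_real]

theorem rho_eq_integral (σ b t : ℝ) (x : ℚ_[p]) :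
    rho σ b t x = ∫ y, chi (y * x) * (heat σ b t y : ℂ) ∂(haar p) := rfl

/-- Outside B_{1-k} the multiplier is invariant under translation by p⁻¹x⁻¹ while the character
gains χ(p⁻¹), so the integral vanishes there. On B_{1-k} the character has integral zero, so the
value of the multiplier on the boundary sphere can be subtracted for free. What remains lives on
B_{-k}, where the character is 1. -/
theorem rho_eq_rhoProfile {σ b t : ℝ} (hσ : 0 < σ) (hb : 0 < b) (ht : 0 < t) {x : ℚ_[p]} {k : ℤ}
    (hx : ‖x‖ = (p : ℝ) ^ k) : rho σ b t x = (rhoProfile p σ b t k : ℂ) := by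
  have hp := one_lt_cast_prime p
  have hp0 : (p : ℝ) ≠ 0 := (zero_lt_one.trans hp).ne'
  have hx0 : x ≠ 0 := norm_pos_iff.1 (hx ▸ zpow_prime_pos p k)
  set e : ℝ := Real.exp (-σ * t * ((p : ℝ) ^ (1 - k)) ^ b) with he
  set S : Set ℚ_[p] := ball p (1 - k) 0 with hS
  have hSm : MeasurableSet S := measurableSet_ball _ _
  have hF := integrable_chi_mul_heat hσ hb ht x
  have hu : (p : ℚ_[p])⁻¹ * x⁻¹ ∈ S := by
    rw [hS, mem_ball_zero, norm_mul, norm_inv, norm_inv, Padic.norm_p, inv_inv, hx, ← zpow_neg,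
      ← zpow_one_add₀ hp0, sub_eq_add_neg]
  have hout : ∫ y in Sᶜ, chi (y * x) * (heat σ b t y : ℂ) ∂(haar p) = 0 := by
    refine setIntegral_eq_zero_of_shift hSm.compl _ ((p : ℚ_[p])⁻¹ * x⁻¹) _
      (chi_inv_prime_ne_one (p := p)) fun y => ?_
    by_cases hy : y ∈ S
    · rw [indicator_of_notMem (by simpa using (add_mem_ball_zero_iff hu).2 hy),
        indicator_of_notMem (by simpa using hy), mul_zero]
    · have hn : ‖y + (p : ℚ_[p])⁻¹ * x⁻¹‖ = ‖y‖ := by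
        rw [add_comm]
        refine norm_add_eq_of_norm_lt (lt_of_le_of_lt (mem_ball_zero.1 hu) ?_)
        simpa [hS, mem_ball_zero] using hy
      rw [indicator_of_mem (by simpa using fun h => hy ((add_mem_ball_zero_iff hu).1 h)),
        indicator_of_mem (by simpa using hy), heat, hn,
        add_mul, chi_add, ← mul_assoc, heat, mul_comm (chi (y * x))]
      congr 3
      field_simp
  have hconst : ∫ y in S, chi (y * x) * (e : ℂ) ∂(haar p) = 0 := by
    rw [integral_mul_const]
    have : x ∉ ball p (-(1 - k)) 0 := by
      rw [mem_ball_zero, hx, not_le]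
      exact zpow_lt_zpow_right₀ hp (by omega)
    have h0 := setIntegral_chi_mul_ball (1 - k) this
    simp_rw [mul_comm x] at h0
    rw [h0, zero_mul]
  have hci : IntegrableOn (fun y => chi (y * x) * (e : ℂ)) S (haar p) := by
    refine ContinuousOn.integrableOn_compact (isCompact_ball _ _) (Continuous.continuousOn ?_)
    exact (continuous_chi.comp (continuous_id.mul continuous_const)).mul continuous_const
  rw [rho_eq_integral, ← integral_add_compl hSm hF, hout, add_zero, rhoProfile, ← integral_complex_ofReal]
  rw [← sub_zero (∫ y in S, _ ∂(haar p)), ← hconst, ← integral_sub hF.integrableOn hci]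
  have hsub : ball p (-k) (0 : ℚ_[p]) ⊆ S := fun y hy => by
    rw [hS, mem_ball_zero]
    exact (mem_ball_zero.1 hy).trans (zpow_le_zpow_right₀ hp.le (by omega))
  refine (setIntegral_eq_of_subset_of_forall_sdiff_eq_zero hSm hsub ?_).trans ?_
  · rintro y ⟨hy, hy'⟩
    have h1 := zpow_le_norm_of_notMem_ball hy'
    have h2 : ‖y‖ = (p : ℝ) ^ (1 - k) :=
      le_antisymm (mem_ball_zero.1 hy) (by rwa [show 1 - k = -k + 1 by ring])
    rw [heat, h2, ← he, sub_self]
  · refine setIntegral_congr_fun (measurableSet_ball _ _) fun y hy => ?_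
    rw [chi_mul_eq_one_of_mem_ball (mem_ball_zero.2 hx.le) hy, ← he, one_mul, one_mul, Complex.ofReal_sub]

end HeatMultiplier

/-! ### Monotonicity, positivity and ball integrals of ρ -/

section Density

variable {p : ℕ} [Fact p.Prime] {σ b t : ℝ}

theorem integrableOn_heat_sub (hb : 0 < b) (t : ℝ) (k : ℤ) (e : ℝ) :
    IntegrableOn (fun y => heat σ b t y - e) (ball p k 0) (haar p) :=
  ContinuousOn.integrableOn_compact (isCompact_ball _ _)
    ((continuous_heat hb t).sub continuous_const).continuousOn

theorem exp_neg_le_heat (hσ : 0 < σ) (hb : 0 < b) (ht : 0 < t) {r : ℝ} {y : ℚ_[p]} (hy : ‖y‖ ≤ r) :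
    Real.exp (-σ * t * r ^ b) ≤ heat σ b t y := by
  rw [heat, Real.exp_le_exp, neg_mul, neg_mul, neg_mul, neg_le_neg_iff]
  have := Real.rpow_le_rpow (norm_nonneg y) hy hb.le
  gcongr

theorem rhoProfile_integrand_nonneg (hσ : 0 < σ) (hb : 0 < b) (ht : 0 < t) {k : ℤ} {y : ℚ_[p]}
    (hy : y ∈ ball p (-k) 0) :
    0 ≤ heat σ b t y - Real.exp (-σ * t * ((p : ℝ) ^ (1 - k)) ^ b) := by
  rw [sub_nonneg]
  refine exp_neg_le_heat hσ hb ht ((mem_ball_zero.1 hy).trans ?_)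
  exact zpow_le_zpow_right₀ (one_lt_cast_prime p).le (by omega)

theorem rhoProfile_nonneg (hσ : 0 < σ) (hb : 0 < b) (ht : 0 < t) (k : ℤ) :
    0 ≤ rhoProfile p σ b t k :=
  setIntegral_nonneg (measurableSet_ball _ _) fun _ hy => rhoProfile_integrand_nonneg hσ hb ht hy

theorem ball_zero_subset {j k : ℤ} (h : j ≤ k) : ball p j 0 ⊆ ball p k 0 := fun _ hy =>
  mem_ball_zero.2 ((mem_ball_zero.1 hy).trans (zpow_le_zpow_right₀ (one_lt_cast_prime p).le h))

/-- As the index grows, the domain of a nonnegative integrand shrinks and the constant subtracted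
from the multiplier increases. -/
theorem rhoProfile_antitone (hσ : 0 < σ) (hb : 0 < b) (ht : 0 < t) :
    Antitone (rhoProfile p σ b t) := by
  intro k a hka
  have hp := one_lt_cast_prime p
  calc rhoProfile p σ b t a
      ≤ ∫ y in ball p (-a) 0,
        (heat σ b t y - Real.exp (-σ * t * ((p : ℝ) ^ (1 - k)) ^ b)) ∂(haar p) := by
        refine setIntegral_mono_on (integrableOn_heat_sub hb t _ _) (integrableOn_heat_sub hb t _ _)
          (measurableSet_ball _ _) fun y hy => ?_
        rw [sub_le_sub_iff_left, Real.exp_le_exp, neg_mul, neg_mul, neg_mul, neg_le_neg_iff]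
        have h1 : (p : ℝ) ^ (1 - a) ≤ (p : ℝ) ^ (1 - k) := zpow_le_zpow_right₀ hp.le (by omega)
        have := Real.rpow_le_rpow (zpow_prime_pos p (1 - a)).le h1 hb.le
        gcongr
    _ ≤ rhoProfile p σ b t k := by
        refine setIntegral_mono_set (integrableOn_heat_sub hb t _ _) ?_
          (ball_zero_subset (by omega)).eventuallyLE
        exact (ae_restrict_iff' (measurableSet_ball _ _)).2
          (ae_of_all _ fun y hy => rhoProfile_integrand_nonneg hσ hb ht hy)

theorem rho_zero (σ b t : ℝ) : rho σ b t (0 : ℚ_[p]) = ((∫ y, heat σ b t y ∂(haar p) : ℝ) : ℂ) := by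
  rw [rho_eq_integral, ← integral_complex_ofReal]
  simp [chi_of_norm_le_one]

theorem rhoProfile_le_re_rho (hσ : 0 < σ) (hb : 0 < b) (ht : 0 < t) {a : ℤ} {x : ℚ_[p]}
    (hx : x ∈ ball p a 0) : rhoProfile p σ b t a ≤ (rho σ b t x).re := by
  rcases eq_or_ne x 0 with rfl | hx0
  · rw [rho_zero, Complex.ofReal_re]
    have hi := integrable_heat (p := p) hσ hb ht
    refine le_trans ?_ (setIntegral_le_integral (s := ball p (-a) 0) hi
      (ae_of_all _ fun y => (heat_pos _ _ _ y).le))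
    refine setIntegral_mono_on (integrableOn_heat_sub hb t _ _) hi.integrableOn
      (measurableSet_ball _ _) fun y _ => ?_
    exact sub_le_self _ (Real.exp_pos _).le
  · obtain ⟨k, hk⟩ := exists_norm_eq_zpow hx0
    rw [rho_eq_rhoProfile hσ hb ht hk, Complex.ofReal_re]
    refine rhoProfile_antitone hσ hb ht ?_
    rw [mem_ball_zero, hk] at hx
    exact (zpow_le_zpow_iff_right₀ (one_lt_cast_prime p)).1 hx

theorem exists_mem_ball_zero (x : ℚ_[p]) : ∃ a : ℤ, x ∈ ball p a 0 := by
  obtain ⟨n, hn⟩ := pow_unbounded_of_one_lt ‖x‖ (one_lt_cast_prime p)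
  exact ⟨n, mem_ball_zero.2 (by simpa using hn.le)⟩

theorem re_rho_nonneg (hσ : 0 < σ) (hb : 0 < b) (ht : 0 < t) (x : ℚ_[p]) :
    0 ≤ (rho σ b t x).re := by
  obtain ⟨a, ha⟩ := exists_mem_ball_zero x
  exact (rhoProfile_nonneg hσ hb ht a).trans (rhoProfile_le_re_rho hσ hb ht ha)

theorem rho_congr_norm (hσ : 0 < σ) (hb : 0 < b) (ht : 0 < t) {x y : ℚ_[p]} (h : ‖x‖ = ‖y‖) :
    rho σ b t x = rho σ b t y := by
  rcases eq_or_ne x 0 with rfl | hx0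
  · rw [norm_eq_zero.1 (h.symm.trans norm_zero)]
  · obtain ⟨k, hk⟩ := exists_norm_eq_zpow hx0
    rw [rho_eq_rhoProfile hσ hb ht hk, rho_eq_rhoProfile hσ hb ht (h ▸ hk)]

theorem continuous_rho (hσ : 0 < σ) (hb : 0 < b) (ht : 0 < t) :
    Continuous (rho σ b t : ℚ_[p] → ℂ) := by
  simp_rw [funext (rho_eq_integral (p := p) σ b t)]
  refine continuous_of_dominated (bound := heat σ b t)
    (fun x => (integrable_chi_mul_heat hσ hb ht x).aestronglyMeasurable)
    (fun x => ae_of_all _ fun y => ?_) (integrable_heat hσ hb ht) (ae_of_all _ fun y => ?_)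
  · rw [norm_mul, norm_chi, one_mul, Complex.norm_real, Real.norm_of_nonneg (heat_pos _ _ _ y).le]
  · exact (continuous_chi.comp (continuous_const.mul continuous_id)).mul continuous_const

/-- By Fubini: the Fourier transform of the indicator of B_a is μ(B_a) times the indicator of
B_{-a}. -/
theorem setIntegral_rho_ball (hσ : 0 < σ) (hb : 0 < b) (ht : 0 < t) (a : ℤ) :
    ∫ x in ball p a 0, rho σ b t x ∂(haar p)
      = (((haar p).real (ball p a 0) * ∫ y in ball p (-a) 0, heat σ b t y ∂(haar p) : ℝ) : ℂ) := by
  have : IsFiniteMeasure ((haar p).restrict (ball p a 0)) :=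
    ⟨by simpa using haar_ball_lt_top a 0⟩
  have hi : Integrable (Function.uncurry fun (x y : ℚ_[p]) => chi (y * x) * (heat σ b t y : ℂ))
      (((haar p).restrict (ball p a 0)).prod (haar p)) := by
    refine ((integrable_heat hσ hb ht).comp_snd ((haar p).restrict (ball p a 0))).mono ?_
      (ae_of_all _ fun z => ?_)
    · exact ((continuous_chi.comp (continuous_snd.mul continuous_fst)).mul
        (Complex.continuous_ofReal.comp ((continuous_heat hb t).comp
          continuous_snd))).aestronglyMeasurable
    · simp only [Function.uncurry]
      rw [norm_mul, norm_chi, one_mul, Complex.norm_real]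
  simp_rw [rho_eq_integral]
  rw [integral_integral_swap hi]
  have hinner : ∀ y : ℚ_[p], ∫ x in ball p a 0, chi (y * x) * (heat σ b t y : ℂ) ∂(haar p)
      = (ball p (-a) 0).indicator
        (fun y => (((haar p).real (ball p a 0) * heat σ b t y : ℝ) : ℂ)) y := by
    intro y
    rw [integral_mul_const]
    by_cases hy : y ∈ ball p (-a) 0
    · rw [indicator_of_mem hy, setIntegral_congr_fun (g := fun _ => (1 : ℂ)) (measurableSet_ball _ _)
        fun x hx => chi_mul_eq_one_of_mem_ball hx hy]
      simp
    · rw [indicator_of_notMem hy, setIntegral_chi_mul_ball a hy, zero_mul]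
  simp_rw [hinner]
  rw [integral_indicator (measurableSet_ball _ _), integral_complex_ofReal, integral_const_mul]

/-- The transition density `ρ(t, ·)`, as a function with values in `[0, ∞]`. -/
noncomputable def density (σ b t : ℝ) (x : ℚ_[p]) : ℝ≥0∞ := ENNReal.ofReal (rho σ b t x).re

theorem measurable_density (hσ : 0 < σ) (hb : 0 < b) (ht : 0 < t) :
    Measurable (density σ b t : ℚ_[p] → ℝ≥0∞) :=
  ENNReal.measurable_ofReal.comp
    (Complex.continuous_re.comp (continuous_rho hσ hb ht)).measurable

theorem density_congr_norm (hσ : 0 < σ) (hb : 0 < b) (ht : 0 < t) {x y : ℚ_[p]} (h : ‖x‖ = ‖y‖) :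
    density σ b t x = density σ b t y := by
  rw [density, density, rho_congr_norm hσ hb ht h]

theorem setLIntegral_density_ball (hσ : 0 < σ) (hb : 0 < b) (ht : 0 < t) (a : ℤ) :
    ∫⁻ x in ball p a 0, density σ b t x ∂(haar p)
      = ENNReal.ofReal ((haar p).real (ball p a 0) *
        ∫ y in ball p (-a) 0, heat σ b t y ∂(haar p)) := by
  have hi : IntegrableOn (fun x => rho σ b t x) (ball p a 0) (haar p) :=
    (continuous_rho hσ hb ht).continuousOn.integrableOn_compact (isCompact_ball _ _)
  simp only [density]
  rw [← ofReal_integral_eq_lintegral_ofReal (f := fun x => (rho σ b t x).re) hi.re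
    (ae_of_all _ fun x => re_rho_nonneg hσ hb ht x)]
  congr 1
  have h1 := setIntegral_rho_ball (p := p) hσ hb ht a
  have h2 := integral_re hi
  rw [h1] at h2
  simpa using h2

end Density

/-! ### Chapman–Kolmogorov and paths confined at grid times -/

section Markov

variable {p : ℕ} [Fact p.Prime] {σ b : ℝ}

theorem setLIntegral_comp_sub {V : Set ℚ_[p]} (hV : MeasurableSet V) (f : ℚ_[p] → ℝ≥0∞)
    (x : ℚ_[p]) :
    ∫⁻ w in V, f (w - x) ∂(haar p) = ∫⁻ w in (fun w => w + x) ⁻¹' V, f w ∂(haar p) := by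
  rw [← lintegral_indicator hV, ← lintegral_indicator (hV.preimage (measurable_add_const x)),
    ← lintegral_add_right_eq_self _ x]
  congr 1 with w
  simp only [indicator, add_sub_cancel_right]
  rfl

theorem setLIntegral_ball_comp_sub (f : ℚ_[p] → ℝ≥0∞) {a : ℤ} {x : ℚ_[p]} (hx : x ∈ ball p a 0) :
    ∫⁻ w in ball p a 0, f (w - x) ∂(haar p) = ∫⁻ w in ball p a 0, f w ∂(haar p) := by
  rw [setLIntegral_comp_sub (measurableSet_ball _ _)]
  congr 2
  ext w
  exact add_mem_ball_zero_iff hx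

theorem TimeInterval.mem_of_le (I : TimeInterval) {s t : ℝ} (hs : 0 ≤ s) (hst : s ≤ t)
    (ht : t ∈ I.carrier) : s ∈ I.carrier := by
  rcases I.isInterval with h | ⟨T, _, h⟩
  · rw [h]; exact hs
  · rw [h] at ht ⊢; exact ⟨hs, hst.trans ht.2⟩

theorem TimeInterval.nonneg (I : TimeInterval) (s : I.carrier) : 0 ≤ (s : ℝ) := by
  obtain ⟨s, hs⟩ := s
  rcases I.isInterval with h | ⟨T, _, h⟩
  · rw [h] at hs; exact hs
  · rw [h] at hs; exact hs.1

variable {I : TimeInterval} {P : Measure (SkorohodSpace I ℚ_[p])}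

theorem IsBrownianLaw.measure_forall_mem (hP : IsBrownianLaw σ b P) (k : ℕ)
    (e : Fin k → I.carrier) (he : ∀ i, 0 < (e i : ℝ)) (hmono : StrictMono e)
    (U : Fin k → Set ℚ_[p]) (hU : ∀ i, MeasurableSet (U i)) :
    P {ω | ∀ i, X (e i) ω ∈ U i} = iterInt σ b k 0 0 (fun i => (e i : ℝ)) U := by
  have h := hP.cylinder_apply
    { length := k
      epoch := e
      epoch_pos := he
      epoch_strictMono := hmono
      route := Fin.cons univ U
      measurableSet_route := fun i => by
        refine Fin.cases ?_ (fun j => ?_) i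
        · exact MeasurableSet.univ
        · exact hU j }
  simpa [History.cylinder] using h

theorem IsBrownianLaw.measure_X_mem (hP : IsBrownianLaw σ b P) (t : I.carrier) (ht : 0 < (t : ℝ))
    {V : Set ℚ_[p]} (hV : MeasurableSet V) :
    P {ω | X t ω ∈ V} = ∫⁻ w in V, density σ b t w ∂(haar p) := by
  have h := hP.measure_forall_mem 1 (fun _ => t) (fun _ => ht)
    (Subsingleton.strictMono _) (fun _ => V) (fun _ => hV)
  simpa [iterInt, density] using h

/-- The consistency of the finite dimensional distributions. -/
theorem IsBrownianLaw.chapman_kolmogorov (hP : IsBrownianLaw σ b P) {h s : ℝ} (hh : 0 < h)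
    (hs : 0 < s) (hmem : h + s ∈ I.carrier) {V : Set ℚ_[p]} (hV : MeasurableSet V) (x : ℚ_[p]) :
    ∫⁻ z, density σ b h (z - x) * ∫⁻ w in V, density σ b s (w - z) ∂(haar p) ∂(haar p)
      = ∫⁻ w in V, density σ b (h + s) (w - x) ∂(haar p) := by
  -- For x = 0 both sides are the law of X_{h+s}, computed with and without an unconstrained
  -- intermediate time. A general starting point then follows by translation.
  have hzero : ∀ {W : Set ℚ_[p]}, MeasurableSet W →
      ∫⁻ z, density σ b h z * ∫⁻ w in W, density σ b s (w - z) ∂(haar p) ∂(haar p)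
        = ∫⁻ w in W, density σ b (h + s) w ∂(haar p) := by
    intro W hW
    have h1 := hP.measure_X_mem ⟨h + s, hmem⟩ (by simpa using add_pos hh hs) hW
    have h2 := hP.measure_forall_mem 2
      ![⟨h, I.mem_of_le hh.le (by linarith) hmem⟩, ⟨h + s, hmem⟩]
      (by intro i; fin_cases i <;> simp [hh, add_pos hh hs])
      (by
        rw [Fin.strictMono_iff_lt_succ]
        intro i
        fin_cases i
        simpa using hs)
      ![univ, W] (by intro i; fin_cases i <;> simp [hW])
    rw [← h1]
    simpa [iterInt, Fin.tail, density] using h2.symm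
  rw [← lintegral_add_right_eq_self _ x, setLIntegral_comp_sub hV,
    ← hzero (hV.preimage (measurable_add_const x))]
  congr 1 with z
  rw [add_sub_cancel_right, ← setLIntegral_comp_sub hV (fun w => density σ b s (w - z))]
  congr 2 with w
  congr 1
  ring

/-- B_a is an additive subgroup, so staying in it means that every increment lies in it, whatever
the starting point. -/
theorem iterInt_eq_pow (hσ : 0 < σ) (hb : 0 < b) {h : ℝ} (hh : 0 < h) (a : ℤ) (k : ℕ) (s : ℝ)
    {x : ℚ_[p]} (hx : x ∈ ball p a 0) (e : Fin k → ℝ) (he : ∀ i, e i = s + ((i : ℕ) + 1) * h) :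
    iterInt σ b k s x e (fun _ => ball p a 0)
      = (∫⁻ z in ball p a 0, density σ b h z ∂(haar p)) ^ k := by
  induction k generalizing s x with
  | zero => simp [iterInt]
  | succ k ih =>
    have h0 : e 0 - s = h := by rw [he]; simp
    have hdx : Measurable fun z : ℚ_[p] => density σ b h (z - x) :=
      (measurable_density hσ hb hh).comp (measurable_sub_const x)
    rw [iterInt, h0, setLIntegral_congr_fun (g := fun z => density σ b h (z - x) *
      (∫⁻ z in ball p a 0, density σ b h z ∂(haar p)) ^ k) (measurableSet_ball _ _),
      lintegral_mul_const _ hdx, setLIntegral_ball_comp_sub (density σ b h) hx, pow_succ']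
    intro z hz
    have := ih (e 0) hz (Fin.tail e) fun i => by
      simp only [Fin.tail, he, Fin.val_succ, Fin.val_zero]
      push_cast
      ring
    simp only [density] at this ⊢
    rw [← this]
    rfl

/-- The central point: κ is the density at the final time of the paths seen outside B_a at an
earlier grid time. It depends neither on the target V nor on the starting point x. The additive form
avoids subtraction in `ℝ≥0∞`. -/
theorem IsBrownianLaw.exists_iterInt_add_eq (hP : IsBrownianLaw σ b P) (hσ : 0 < σ) (hb : 0 < b)
    {h : ℝ} (hh : 0 < h) (a : ℤ) (k : ℕ) (hk : ((k : ℝ) + 1) * h ∈ I.carrier) :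
    ∃ κ : ℝ≥0∞, ∀ V ⊆ ball p a 0, MeasurableSet V → ∀ (s : ℝ) (x : ℚ_[p])
      (e : Fin (k + 1) → ℝ) (U : Fin (k + 1) → Set ℚ_[p]), x ∈ ball p a 0 →
      (∀ i, e i = s + ((i : ℕ) + 1) * h) → (∀ i, i ≠ Fin.last k → U i = ball p a 0) →
      U (Fin.last k) = V →
      iterInt σ b (k + 1) s x e U + haar p V * κ
        = ∫⁻ w in V, density σ b (((k : ℝ) + 1) * h) (w - x) ∂(haar p) := by
  induction k with
  | zero =>
    refine ⟨0, fun V _ _ s x e U _ he _ hU => ?_⟩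
    have h0 : e 0 - s = h := by rw [he]; simp
    have hU0 : U 0 = V := hU
    simp [iterInt, h0, hU0, density]
  | succ k ih =>
    have hk' : ((k : ℝ) + 1) * h ∈ I.carrier := by
      refine I.mem_of_le (by positivity) ?_ hk
      push_cast
      nlinarith
    have hkpos : 0 < ((k : ℝ) + 1) * h := by positivity
    have hsum : h + ((k : ℝ) + 1) * h = (((k + 1 : ℕ) : ℝ) + 1) * h := by push_cast; ring
    obtain ⟨κ, hκ⟩ := ih hk'
    set B := ball p a 0 with hB
    have hBm : MeasurableSet B := measurableSet_ball _ _
    have hd : Measurable (density σ b h : ℚ_[p] → ℝ≥0∞) := measurable_density hσ hb hh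
    -- Split by the position z at the first grid time: either z ∈ B and a later exit is counted by
    -- the old κ, or z is already outside.
    refine ⟨κ * (∫⁻ z in B, density σ b h z ∂(haar p)) +
      ∫⁻ z in Bᶜ, density σ b h z * density σ b (((k : ℝ) + 1) * h) z ∂(haar p),
      fun V hVB hV s x e U hx he hUB hUV => ?_⟩
    have h0 : e 0 - s = h := by rw [he]; simp
    have hU0 : U 0 = B := hUB 0 (Fin.last_pos).ne
    set J : ℚ_[p] → ℝ≥0∞ :=
      fun z => ∫⁻ w in V, density σ b (((k : ℝ) + 1) * h) (w - z) ∂(haar p) with hJ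
    have hin : iterInt σ b (k + 1 + 1) s x e U
        + haar p V * (κ * ∫⁻ z in B, density σ b h z ∂(haar p))
        = ∫⁻ z in B, density σ b h (z - x) * J z ∂(haar p) := by
      have hdx : Measurable fun z : ℚ_[p] => density σ b h (z - x) :=
        hd.comp (measurable_sub_const x)
      rw [iterInt, h0, hU0, ← setLIntegral_ball_comp_sub (density σ b h) hx, ← mul_assoc,
        ← lintegral_const_mul _ hdx, ← lintegral_add_right _ (hdx.const_mul _)]
      refine setLIntegral_congr_fun hBm fun z hz => ?_
      have := hκ V hVB hV (e 0) z (Fin.tail e) (Fin.tail U) hz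
        (fun i => by
          simp only [Fin.tail, he, Fin.val_succ, Fin.val_zero]
          push_cast
          ring)
        (fun i hi => hUB _ (by simpa [← Fin.succ_last] using hi))
        (by simpa [Fin.tail] using hUV)
      simp only [hJ]
      rw [← this, density]
      ring
    have hout : haar p V * ∫⁻ z in Bᶜ, density σ b h z * density σ b (((k : ℝ) + 1) * h) z ∂(haar p)
        = ∫⁻ z in Bᶜ, density σ b h (z - x) * J z ∂(haar p) := by
      have hdd : Measurable fun z : ℚ_[p] => density σ b h z * density σ b (((k : ℝ) + 1) * h) z :=
        hd.mul (measurable_density hσ hb hkpos)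
      rw [← lintegral_const_mul _ hdd]
      refine setLIntegral_congr_fun hBm.compl fun z hz => ?_
      -- By the ultrametric inequality the jumps from x ∈ B to z and from z to w ∈ V both have norm
      -- |z|, so neither density sees x or w.
      have hlt : ∀ y ∈ B, ‖y‖ < ‖z‖ := fun y hy => by
        refine (mem_ball_zero.1 hy).trans_lt ?_
        simpa [hB, mem_ball_zero] using hz
      have h1 : density σ b h (z - x) = density σ b h z := by
        refine density_congr_norm hσ hb hh ?_
        rw [sub_eq_add_neg, add_comm, norm_add_eq_of_norm_lt (by rw [norm_neg]; exact hlt x hx)]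
      have h2 : J z = haar p V * density σ b (((k : ℝ) + 1) * h) z := by
        simp only [hJ]
        rw [setLIntegral_congr_fun (g := fun _ => density σ b (((k : ℝ) + 1) * h) z) hV,
          setLIntegral_const, mul_comm]
        intro w hw
        refine density_congr_norm hσ hb hkpos ?_
        rw [sub_eq_add_neg, norm_add_eq_of_norm_lt (by rw [norm_neg]; exact hlt w (hVB hw)),
          norm_neg]
      simp only [h1, h2]
      ring
    rw [mul_add, ← add_assoc, hin, hout, lintegral_add_compl _ hBm,
      hP.chapman_kolmogorov hh hkpos (by rwa [hsum]) hV, hsum]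

end Markov

/-! ### From dyadic grids to the running supremum -/

section Paths

variable {p : ℕ} [Fact p.Prime] {σ b : ℝ} {I : TimeInterval}

theorem measurable_X (t : I.carrier) :
    Measurable (X t : SkorohodSpace I ℚ_[p] → ℚ_[p]) :=
  (comap_measurable _).mono
    (le_iSup (fun t : I.carrier => MeasurableSpace.comap (X t) inferInstance) t) le_rfl

theorem enorm_le_zpow_iff {a : ℤ} {x : ℚ_[p]} : ‖x‖ₑ ≤ (p : ℝ≥0∞) ^ a ↔ x ∈ ball p a 0 := by
  have hp : (p : NNReal) ≠ 0 := by exact_mod_cast (Fact.out : p.Prime).ne_zero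
  rw [mem_ball_zero, ← ENNReal.coe_natCast, ← ENNReal.coe_zpow hp, enorm_le_coe, ← NNReal.coe_le_coe]
  simp

theorem supNorm_le_zpow_iff {a : ℤ} {t : I.carrier} {ω : SkorohodSpace I ℚ_[p]} :
    supNorm t ω ≤ (p : ℝ≥0∞) ^ a ↔ ∀ s ≤ t, X s ω ∈ ball p a 0 := by
  simp only [supNorm, iSup_le_iff, enorm_le_zpow_iff]

/-- The points `t / N, 2 t / N, …, t`. -/
noncomputable def gridTime (t : I.carrier) (N : ℕ) (j : Fin N) : I.carrier :=
  ⟨((j : ℕ) + 1) * ((t : ℝ) / N), by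
    have hN : (0 : ℝ) < N := by exact_mod_cast j.pos
    have ht := I.nonneg t
    refine I.mem_of_le (by positivity) ?_ t.2
    have hj : ((j : ℕ) : ℝ) + 1 ≤ N := by exact_mod_cast j.2
    calc (((j : ℕ) : ℝ) + 1) * ((t : ℝ) / N) ≤ N * ((t : ℝ) / N) := by gcongr
      _ = t := by field_simp⟩

/-- The event that the path is in `B_a` at the points `t / N, 2 t / N, …, t`. -/
def gridStays (p : ℕ) [Fact p.Prime] (a : ℤ) (t : I.carrier) (N : ℕ) :
    Set (SkorohodSpace I ℚ_[p]) :=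
  {ω | ∀ j, X (gridTime t N j) ω ∈ ball p a 0}

theorem measurableSet_gridStays (a : ℤ) (t : I.carrier) (N : ℕ) :
    MeasurableSet (gridStays p a t N) := by
  rw [gridStays, ofPred_forall]
  exact MeasurableSet.iInter fun j => measurable_X _ (measurableSet_ball a 0)

theorem antitone_gridStays (a : ℤ) (t : I.carrier) :
    Antitone fun n : ℕ => gridStays p a t (2 ^ n) := by
  refine antitone_nat_of_succ_le fun n ω hω j => ?_
  have hlt : 2 * (j : ℕ) + 1 < 2 ^ (n + 1) := by
    have := j.2
    rw [pow_succ]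
    omega
  -- Index j stands for time (j + 1)t/N, and 2(j + 1) = (2j + 1) + 1.
  convert hω ⟨2 * j + 1, hlt⟩ using 2
  refine Subtype.ext ?_
  simp only [gridTime]
  push_cast
  field_simp
  ring

theorem gridTime_last (t : I.carrier) (k : ℕ) : gridTime t (k + 1) (Fin.last k) = t := by
  refine Subtype.ext ?_
  have : (k : ℝ) + 1 ≠ 0 := by positivity
  simp only [gridTime, Fin.val_last]
  push_cast
  field_simp

theorem strictMono_gridTime (t : I.carrier) (ht : 0 < (t : ℝ)) (N : ℕ) :
    StrictMono (gridTime t N) := by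
  intro i j hij
  have hN : (0 : ℝ) < N := by exact_mod_cast i.pos
  have h : ((i : ℕ) : ℝ) < (j : ℕ) := by exact_mod_cast hij
  rw [← Subtype.coe_lt_coe]
  simp only [gridTime]
  gcongr

theorem gridTime_pos (t : I.carrier) (ht : 0 < (t : ℝ)) (N : ℕ) (j : Fin N) :
    0 < (gridTime t N j : ℝ) := by
  have hN : (0 : ℝ) < N := by exact_mod_cast j.pos
  simp only [gridTime]
  positivity

/-- By right continuity, a path stays in `B_a` if it does so on the dyadic grids. -/
theorem setOf_supNorm_le_eq_iInter (a : ℤ) (t : I.carrier) (ht : 0 < (t : ℝ)) :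
    {ω : SkorohodSpace I ℚ_[p] | supNorm t ω ≤ (p : ℝ≥0∞) ^ a}
      = ⋂ n : ℕ, gridStays p a t (2 ^ n) := by
  ext ω
  rw [mem_ofPred_eq, supNorm_le_zpow_iff, mem_iInter]
  refine ⟨fun h n j => h _ ?_, fun h s hst => ?_⟩
  · obtain ⟨k, hk⟩ := Nat.exists_eq_succ_of_ne_zero (pow_ne_zero n (two_ne_zero : (2 : ℕ) ≠ 0))
    generalize 2 ^ n = N at j hk
    subst hk
    exact ((strictMono_gridTime t ht _).monotone (Fin.le_last j)).trans_eq (gridTime_last t k)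
  by_contra hs
  -- The endpoint t has no grid time to its right, but it belongs to the grid with n = 0.
  have hst' : (s : ℝ) < t := by
    refine lt_of_le_of_ne hst fun heq => hs ?_
    have h0 := h 0 ⟨0, by simp⟩
    convert h0 using 2
    refine Subtype.ext ?_
    simp [gridTime, heq]
  have hev : ∀ᶠ u in 𝓝[≥] s, ω.1 u ∈ (ball p a 0)ᶜ :=
    (ω.2 s).1 ((isClosed_ball a 0).isOpen_compl.mem_nhds hs)
  rw [Filter.Eventually, Metric.mem_nhdsWithin_iff] at hev
  obtain ⟨ε, hε, hsub⟩ := hev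
  obtain ⟨n, hn⟩ := pow_unbounded_of_one_lt ((t : ℝ) / ε) (one_lt_two (α := ℝ))
  have h2 : (0 : ℝ) < 2 ^ n := by positivity
  set δ : ℝ := (t : ℝ) / 2 ^ n with hδ
  have hδ0 : 0 < δ := by positivity
  have hδε : δ < ε := by
    rw [div_lt_iff₀ hε] at hn
    rw [hδ, div_lt_iff₀ h2]
    linarith
  have hs0 := I.nonneg s
  have hfl : (⌊(s : ℝ) / δ⌋₊ : ℝ) * δ ≤ s := by
    rw [← le_div_iff₀ hδ0]; exact Nat.floor_le (by positivity)
  -- The next grid time after s lies within δ < ε of s, where right continuity still keeps the path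
  -- outside the closed ball.
  have hfl' : (s : ℝ) < (⌊(s : ℝ) / δ⌋₊ + 1) * δ := by
    rw [← div_lt_iff₀ hδ0]; exact Nat.lt_floor_add_one _
  have hlt : ⌊(s : ℝ) / δ⌋₊ < 2 ^ n := by
    rw [Nat.floor_lt (by positivity), div_lt_iff₀ hδ0, hδ]
    push_cast
    rwa [mul_div_cancel₀ _ h2.ne']
  set u := gridTime t (2 ^ n) ⟨_, hlt⟩ with hu
  have huval : (u : ℝ) = (⌊(s : ℝ) / δ⌋₊ + 1) * δ := by
    simp [hu, gridTime, hδ]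
  suffices hmem : u ∈ Metric.ball s ε ∩ Ici s from hsub hmem (h n ⟨_, hlt⟩)
  constructor
  · rw [Metric.mem_ball, Subtype.dist_eq, Real.dist_eq, huval, abs_lt]
    constructor <;> linarith
  · rw [mem_Ici, ← Subtype.coe_le_coe, huval]
    exact hfl'.le

variable {P : Measure (SkorohodSpace I ℚ_[p])}

theorem IsBrownianLaw.measure_gridStays (hP : IsBrownianLaw σ b P) (hσ : 0 < σ) (hb : 0 < b)
    (a : ℤ) (t : I.carrier) (ht : 0 < (t : ℝ)) {N : ℕ} (hN : 0 < N) :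
    P (gridStays p a t N) = (∫⁻ z in ball p a 0, density σ b ((t : ℝ) / N) z ∂(haar p)) ^ N := by
  rw [gridStays, hP.measure_forall_mem N _ (gridTime_pos t ht N) (strictMono_gridTime t ht N)
    (fun _ => ball p a 0) fun _ => measurableSet_ball _ _]
  refine iterInt_eq_pow hσ hb (by positivity) a N 0 ?_ _ fun i => by simp [gridTime]
  simpa [mem_ball_zero] using (zpow_prime_pos p a).le

/-- The same κ serves V and the whole ball B_a; eliminating it between the two identities leaves
only probabilities. -/
theorem IsBrownianLaw.measure_gridStays_inter (hP : IsBrownianLaw σ b P) (hσ : 0 < σ) (hb : 0 < b)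
    (a : ℤ) (t : I.carrier) (ht : 0 < (t : ℝ)) {N : ℕ} (hN : 0 < N) {V : Set ℚ_[p]}
    (hV : MeasurableSet V) (hVB : V ⊆ ball p a 0) :
    haar p (ball p a 0) * P (gridStays p a t N ∩ {ω | X t ω ∈ V})
        + haar p V * P {ω | X t ω ∈ ball p a 0}
      = haar p (ball p a 0) * P {ω | X t ω ∈ V} + haar p V * P (gridStays p a t N) := by
  obtain ⟨k, rfl⟩ := Nat.exists_eq_succ_of_ne_zero hN.ne'
  have htk : ((k : ℝ) + 1) * ((t : ℝ) / (k + 1 : ℕ)) = t := by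
    have : (k : ℝ) + 1 ≠ 0 := by positivity
    push_cast
    field_simp
  obtain ⟨κ, hκ⟩ := hP.exists_iterInt_add_eq hσ hb (h := (t : ℝ) / (k + 1 : ℕ)) (by positivity) a k
    (by rw [htk]; exact t.2)
  have key : ∀ W ⊆ ball p a 0, MeasurableSet W →
      P (gridStays p a t (k + 1) ∩ {ω | X t ω ∈ W}) + haar p W * κ = P {ω | X t ω ∈ W} := by
    intro W hWB hW
    have hset : gridStays p a t (k + 1) ∩ {ω | X t ω ∈ W}
        = {ω | ∀ j, X (gridTime t (k + 1) j) ω ∈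
          (Function.update (fun _ => ball p a 0) (Fin.last k) W : Fin (k + 1) → Set ℚ_[p]) j} := by
      ext ω
      simp only [gridStays, mem_inter_iff, mem_ofPred_eq]
      constructor
      · rintro ⟨h1, h2⟩ j
        rcases eq_or_ne j (Fin.last k) with rfl | hj
        · rwa [Function.update_self, gridTime_last]
        · rw [Function.update_of_ne hj]; exact h1 j
      · intro h
        have hl := h (Fin.last k)
        rw [Function.update_self, gridTime_last] at hl
        refine ⟨fun j => ?_, hl⟩
        rcases eq_or_ne j (Fin.last k) with rfl | hj
        · rw [gridTime_last]; exact hWB hl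
        · have := h j
          rwa [Function.update_of_ne hj] at this
    rw [hset, hP.measure_forall_mem (k + 1) _ (gridTime_pos t ht _) (strictMono_gridTime t ht _),
      hκ W hWB hW 0 0 _ _ (by simpa [mem_ball_zero] using (zpow_prime_pos p a).le)
        (fun i => by simp [gridTime]) (fun i hi => Function.update_of_ne hi _ _)
        (Function.update_self _ _ _), htk, hP.measure_X_mem t ht hW]
    · simp
    · intro i
      rcases eq_or_ne i (Fin.last k) with rfl | hi
      · rwa [Function.update_self]
      · rw [Function.update_of_ne hi]; exact measurableSet_ball _ _
  have h1 := key V hVB hV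
  have h2 := key _ subset_rfl (measurableSet_ball a 0)
  have h3 : gridStays p a t (k + 1) ∩ {ω | X t ω ∈ ball p a 0} = gridStays p a t (k + 1) := by
    refine inter_eq_left.2 fun ω hω => ?_
    have := hω (Fin.last k)
    rwa [gridTime_last] at this
  rw [h3] at h2
  rw [← h1, ← h2]
  ring

theorem IsBrownianLaw.measure_supNorm_le_inter (hP : IsBrownianLaw σ b P) (hσ : 0 < σ) (hb : 0 < b)
    (a : ℤ) (t : I.carrier) (ht : 0 < (t : ℝ)) {V : Set ℚ_[p]}
    (hV : MeasurableSet V) (hVB : V ⊆ ball p a 0) :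
    haar p (ball p a 0) * P ({ω | supNorm t ω ≤ (p : ℝ≥0∞) ^ a} ∩ {ω | X t ω ∈ V})
        + haar p V * P {ω | X t ω ∈ ball p a 0}
      = haar p (ball p a 0) * P {ω | X t ω ∈ V}
        + haar p V * P {ω | supNorm t ω ≤ (p : ℝ≥0∞) ^ a} := by
  have := hP.isProbabilityMeasure
  have hVtop : haar p V ≠ ∞ := ((measure_mono hVB).trans_lt (haar_ball_lt_top a 0)).ne
  rw [setOf_supNorm_le_eq_iInter a t ht]
  have hl1 : Tendsto (fun n : ℕ => P (gridStays p a t (2 ^ n))) atTop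
      (𝓝 (P (⋂ n : ℕ, gridStays p a t (2 ^ n)))) :=
    tendsto_measure_iInter_atTop (fun n => (measurableSet_gridStays a t _).nullMeasurableSet)
      (antitone_gridStays a t) ⟨0, measure_ne_top _ _⟩
  have hl2 : Tendsto (fun n : ℕ => P (gridStays p a t (2 ^ n) ∩ {ω | X t ω ∈ V})) atTop
      (𝓝 (P ((⋂ n : ℕ, gridStays p a t (2 ^ n)) ∩ {ω | X t ω ∈ V}))) := by
    rw [iInter_inter]
    exact tendsto_measure_iInter_atTop
      (fun n => ((measurableSet_gridStays a t _).inter (measurable_X t hV)).nullMeasurableSet)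
      (fun m n hmn => inter_subset_inter_left _ (antitone_gridStays a t hmn))
      ⟨0, measure_ne_top _ _⟩
  have hl3 := (ENNReal.Tendsto.const_mul hl2
    (Or.inr (haar_ball_lt_top (p := p) a 0).ne)).add_const (haar p V * P {ω | X t ω ∈ ball p a 0})
  have hl4 := (ENNReal.Tendsto.const_mul hl1 (Or.inr hVtop)).const_add
    (haar p (ball p a 0) * P {ω | X t ω ∈ V})
  refine tendsto_nhds_unique hl3 (hl4.congr fun n => ?_)
  exact (hP.measure_gridStays_inter hσ hb a t ht (by positivity) hV hVB).symm

theorem IsBrownianLaw.le_measure_supNorm_le (hP : IsBrownianLaw σ b P)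
    (a : ℤ) (t : I.carrier) (ht : 0 < (t : ℝ)) {m : ℝ≥0∞}
    (hm : ∀ n : ℕ, m ≤ P (gridStays p a t (2 ^ n))) :
    m ≤ P {ω | supNorm t ω ≤ (p : ℝ≥0∞) ^ a} := by
  have := hP.isProbabilityMeasure
  rw [setOf_supNorm_le_eq_iInter a t ht]
  exact ge_of_tendsto' (tendsto_measure_iInter_atTop
    (fun n => (measurableSet_gridStays a t _).nullMeasurableSet)
    (antitone_gridStays a t) ⟨0, measure_ne_top _ _⟩) hm

end Paths

/-! ### Jensen and chord bounds for means over balls -/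

section Convexity

variable {p : ℕ} [Fact p.Prime] {σ b t : ℝ}

theorem integrableOn_norm_rpow (hb : 0 < b) (k : ℤ) :
    IntegrableOn (fun y : ℚ_[p] => ‖y‖ ^ b) (ball p k 0) (haar p) :=
  ContinuousOn.integrableOn_compact (isCompact_ball _ _)
    (continuous_norm.rpow_const fun _ => Or.inr hb.le).continuousOn

theorem integrableOn_const_ball (k : ℤ) (c : ℝ) :
    IntegrableOn (fun _ : ℚ_[p] => c) (ball p k 0) (haar p) :=
  ContinuousOn.integrableOn_compact (isCompact_ball _ _) continuousOn_const

/-- The mean value of `|y| ^ b` on the ball `B_k`. -/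
noncomputable def meanNormPow (p : ℕ) [Fact p.Prime] (b : ℝ) (k : ℤ) : ℝ :=
  (haar p).real (ball p (-k) 0) * ∫ y in ball p k 0, ‖y‖ ^ b ∂(haar p)

/-- The mean value of the heat multiplier on the ball `B_k`. -/
noncomputable def meanHeat (p : ℕ) [Fact p.Prime] (σ b t : ℝ) (k : ℤ) : ℝ :=
  (haar p).real (ball p (-k) 0) * ∫ y in ball p k 0, heat σ b t y ∂(haar p)

theorem haar_real_ball_pos (k : ℤ) (x : ℚ_[p]) : 0 < (haar p).real (ball p k x) :=
  ENNReal.toReal_pos (haar_ball_pos k x).ne' (haar_ball_lt_top k x).ne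

/-- The tangent and the chord of exp are both affine in |y|^b, so this evaluates the means of both
bounds. -/
theorem mean_affine (hb : 0 < b) (k : ℤ) (A B : ℝ) :
    (haar p).real (ball p (-k) 0) * ∫ y in ball p k 0, (A + B * ‖y‖ ^ b) ∂(haar p)
      = A + B * meanNormPow p b k := by
  have h1 := haar_real_ball_mul_haar_real_ball_neg (p := p) k
  rw [integral_add (integrableOn_const_ball k A) ((integrableOn_norm_rpow hb k).const_mul B),
    integral_const_mul, setIntegral_const, smul_eq_mul, meanNormPow]
  linear_combination A * h1

/-- Jensen's inequality, proved by integrating the tangent line of exp at the mean. -/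
theorem exp_neg_meanNormPow_le_meanHeat (hb : 0 < b) (k : ℤ) :
    Real.exp (-σ * t * meanNormPow p b k) ≤ meanHeat p σ b t k := by
  set c := meanNormPow p b k with hc
  set e := Real.exp (-σ * t * c) with he
  have h := mean_affine (p := p) hb k (e * (1 + σ * t * c)) (-(e * (σ * t)))
  rw [← hc] at h
  have h2 : e = e * (1 + σ * t * c) + -(e * (σ * t)) * c := by ring
  rw [h2, ← h, meanHeat]
  refine mul_le_mul_of_nonneg_left ?_ (haar_real_ball_pos _ _).le
  refine setIntegral_mono_on ((integrableOn_const_ball k _).add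
    ((integrableOn_norm_rpow hb k).const_mul _)) (by simpa using integrableOn_heat_sub hb t k 0)
    (measurableSet_ball _ _) fun y _ => ?_
  have h3 := Real.add_one_le_exp (-σ * t * ‖y‖ ^ b - -σ * t * c)
  have h4 : heat σ b t y = e * Real.exp (-σ * t * ‖y‖ ^ b - -σ * t * c) := by
    rw [he, ← Real.exp_add, heat]; congr 1; ring
  rw [h4]
  have h5 := mul_le_mul_of_nonneg_left h3 (Real.exp_pos (-σ * t * c)).le
  rw [← he] at h5
  linarith

/-- On the ball |y|^b lies in [0, C], so the multiplier is below its chord between 0 and C. -/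
theorem meanHeat_le (hb : 0 < b) (k : ℤ) {C : ℝ} (hC : 0 < C)
    (hkC : ((p : ℝ) ^ k) ^ b ≤ C) :
    meanHeat p σ b t k ≤ 1 - meanNormPow p b k / C * (1 - Real.exp (-σ * t * C)) := by
  set E := Real.exp (-σ * t * C) with hE
  have h := mean_affine (p := p) hb k 1 (-((1 - E) / C))
  have h2 : 1 - meanNormPow p b k / C * (1 - E) = 1 + -((1 - E) / C) * meanNormPow p b k := by ring
  rw [h2, ← h, meanHeat]
  refine mul_le_mul_of_nonneg_left ?_ (haar_real_ball_pos _ _).le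
  refine setIntegral_mono_on (by simpa using integrableOn_heat_sub hb t k 0)
    ((integrableOn_const_ball k _).add ((integrableOn_norm_rpow hb k).const_mul _))
    (measurableSet_ball _ _) fun y hy => ?_
  have hy1 : ‖y‖ ^ b ≤ C :=
    (Real.rpow_le_rpow (norm_nonneg y) (mem_ball_zero.1 hy) hb.le).trans hkC
  have hy0 : 0 ≤ ‖y‖ ^ b := by positivity
  have hconv := convexOn_exp.2 (mem_univ (0 : ℝ)) (mem_univ (-σ * t * C))
    (show 0 ≤ 1 - ‖y‖ ^ b / C from sub_nonneg.2 ((div_le_one hC).2 hy1))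
    (show 0 ≤ ‖y‖ ^ b / C by positivity) (by ring)
  rw [smul_eq_mul, smul_eq_mul, smul_eq_mul, smul_eq_mul, Real.exp_zero, ← hE] at hconv
  have h4 : heat σ b t y
      = Real.exp ((1 - ‖y‖ ^ b / C) * 0 + ‖y‖ ^ b / C * (-σ * t * C)) := by
    rw [heat]; congr 1; field_simp; ring
  rw [h4]
  refine hconv.trans_eq ?_
  ring

theorem meanNormPow_pos (hb : 0 < b) (k : ℤ) : 0 < meanNormPow p b k := by
  refine mul_pos (haar_real_ball_pos _ _) ?_
  rw [setIntegral_pos_iff_support_of_nonneg_ae (ae_of_all _ fun y => by positivity)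
    (integrableOn_norm_rpow hb k)]
  have hp := one_lt_cast_prime p
  -- A ball of radius p^{k-1} about a point of norm p^k stays on that sphere, which gives the
  -- support positive measure.
  set x : ℚ_[p] := (p : ℚ_[p]) ^ (-k) with hx
  have hxn : ‖x‖ = (p : ℝ) ^ k := by rw [hx, Padic.norm_p_zpow, neg_neg]
  refine (haar_ball_pos (k - 1) x).trans_le (measure_mono fun y hy => ?_)
  have hyn : ‖y‖ = (p : ℝ) ^ k := by
    rw [← sub_add_cancel y x, norm_add_eq_of_norm_lt, hxn]
    refine (mem_ball.1 hy).trans_lt ?_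
    rw [hxn]
    exact zpow_lt_zpow_right₀ hp (by omega)
  refine ⟨?_, mem_ball_zero.2 hyn.le⟩
  rw [Function.mem_support, hyn]
  exact (Real.rpow_pos_of_pos (zpow_prime_pos p k) b).ne'

theorem meanNormPow_le (hb : 0 < b) (k : ℤ) : meanNormPow p b k ≤ ((p : ℝ) ^ k) ^ b := by
  have h := mean_affine (p := p) hb k (((p : ℝ) ^ k) ^ b) 0
  rw [zero_mul, add_zero] at h
  rw [← h, meanNormPow]
  refine mul_le_mul_of_nonneg_left ?_ (haar_real_ball_pos _ _).le
  refine setIntegral_mono_on (integrableOn_norm_rpow hb k) (by simpa using integrableOn_const_ball k _)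
    (measurableSet_ball _ _) fun y hy => ?_
  rw [zero_mul, add_zero]
  exact Real.rpow_le_rpow (norm_nonneg y) (mem_ball_zero.1 hy) hb.le

/-- The strict convexity of `exp`, in the form of a chord estimate for `exp (-·)`. -/
theorem exp_neg_lt_exp_neg_mul {s c C : ℝ} (hs : 0 < s) (hc : 0 < c) (hcC : c < C) :
    Real.exp (-s * C)
      < Real.exp (-s * c) * (c / C * (1 - Real.exp (-s * C)) + Real.exp (-s * C)) := by
  have hC : 0 < C := hc.trans hcC
  have h := strictConvexOn_exp.2 (mem_univ (0 : ℝ)) (mem_univ (s * C)) (mul_pos hs hC).ne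
    (show 0 < 1 - c / C from sub_pos.2 ((div_lt_one hC).2 hcC)) (show 0 < c / C by positivity)
    (by ring)
  have h1 : (1 - c / C) • (0 : ℝ) + (c / C) • (s * C) = s * c := by
    simp only [smul_eq_mul]; field_simp; ring
  rw [h1, smul_eq_mul, smul_eq_mul, Real.exp_zero] at h
  have e1 : Real.exp (-s * c) * Real.exp (s * c) = 1 := by rw [← Real.exp_add]; simp
  have e2 : Real.exp (-s * C) * Real.exp (s * C) = 1 := by rw [← Real.exp_add]; simp
  have h2 := mul_lt_mul_of_pos_left h (mul_pos (Real.exp_pos (-s * c)) (Real.exp_pos (-s * C)))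
  calc Real.exp (-s * C)
      = Real.exp (-s * c) * Real.exp (-s * C) * Real.exp (s * c) := by
        linear_combination -Real.exp (-s * C) * e1
    _ < _ := h2
    _ = _ := by linear_combination (Real.exp (-s * c) * (c / C)) * e2

theorem rhoProfile_eq (hb : 0 < b) (t : ℝ) (a : ℤ) :
    rhoProfile p σ b t a = (haar p).real (ball p (-a) 0) *
      (meanHeat p σ b t (-a) - Real.exp (-σ * t * ((p : ℝ) ^ (1 - a)) ^ b)) := by
  have h1 := haar_real_ball_mul_haar_real_ball_neg (p := p) a
  rw [rhoProfile, integral_sub ((continuous_heat hb t).continuousOn.integrableOn_compact (isCompact_ball _ _))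
    (integrableOn_const_ball _ _), setIntegral_const, smul_eq_mul, meanHeat, neg_neg]
  linear_combination -(∫ y in ball p (-a) 0, heat σ b t y ∂(haar p)) * h1

end Convexity

end PadicBrownian

/-! ### The strict conditional inequality -/

theorem proposition6 (p : ℕ) [Fact p.Prime] (σ b : ℝ) (hσ : 0 < σ) (hb : 0 < b)
    (I : PadicBrownian.TimeInterval) (P : Measure (PadicBrownian.SkorohodSpace I ℚ_[p]))
    (hP : PadicBrownian.IsBrownianLaw σ b P)
    (a : ℤ) (t : I.carrier) (ht : 0 < (t : ℝ))
    (y : ℚ_[p]) (hy : y ∈ PadicBrownian.ball p a 0)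
    (n : ℕ) (hn : 0 < n)
    (hsub : PadicBrownian.ball p (-(n : ℤ)) y ⊆ PadicBrownian.ball p a 0) :
    P[{ω | PadicBrownian.supNorm t ω ≤ (p : ℝ≥0∞) ^ a} |
        {ω | PadicBrownian.X t ω ∈ PadicBrownian.ball p (-(n : ℤ)) y}] >
      P {ω | PadicBrownian.supNorm t ω ≤ (p : ℝ≥0∞) ^ a} := by
  open PadicBrownian in
  have := hP.isProbabilityMeasure
  have hp := one_lt_cast_prime p
  set U := ball p (-(n : ℤ)) y with hU
  set A := {ω : SkorohodSpace I ℚ_[p] | supNorm t ω ≤ (p : ℝ≥0∞) ^ a} with hA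
  set W := {ω : SkorohodSpace I ℚ_[p] | X t ω ∈ U} with hW
  have hUm : MeasurableSet U := measurableSet_ball _ _
  -- The value of |y|^b on the first sphere outside B_{-a}, hence strictly above its mean c over
  -- B_{-a}.
  set C : ℝ := ((p : ℝ) ^ (1 - a)) ^ b with hC
  set c : ℝ := meanNormPow p b (-a) with hc
  set E : ℝ := Real.exp (-σ * t * C) with hE
  set M : ℝ := meanHeat p σ b t (-a) with hM
  set L : ℝ := (haar p).real (ball p (-a) 0) with hL
  have hC0 : 0 < C := Real.rpow_pos_of_pos (zpow_prime_pos p _) b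
  have hkC : ((p : ℝ) ^ (-a)) ^ b < C :=
    Real.rpow_lt_rpow (zpow_prime_pos p _).le (zpow_lt_zpow_right₀ hp (by omega)) hb
  have hc0 : 0 < c := meanNormPow_pos hb _
  have hcC : c < C := (meanNormPow_le hb _).trans_lt hkC
  have hL0 : 0 < L := haar_real_ball_pos _ _
  have hvL : (haar p).real (ball p a 0) * L = 1 := haar_real_ball_mul_haar_real_ball_neg a
  have hmass : ∀ s : ℝ, 0 < s → ∫⁻ x in ball p a 0, density σ b s x ∂(haar p)
      = ENNReal.ofReal (meanHeat p σ b s (-a)) := fun s hs => by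
    rw [setLIntegral_density_ball hσ hb hs, meanHeat, neg_neg]
  -- the probability of staying in the ball
  have hstay : Real.exp (-σ * t * c) ≤ P.real A := by
    refine (ENNReal.ofReal_le_iff_le_toReal (measure_ne_top _ _)).1 ?_
    refine hP.le_measure_supNorm_le a t ht fun k => ?_
    have hN : 0 < 2 ^ k := by positivity
    rw [hP.measure_gridStays hσ hb a t ht hN, hmass _ (by positivity)]
    -- The Jensen bound is multiplicative in time, so its 2^k-th power does not depend on the grid.
    have h1 : Real.exp (-σ * t * c)
        = Real.exp (-σ * ((t : ℝ) / (2 ^ k : ℕ)) * c) ^ (2 ^ k) := by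
      rw [← Real.exp_nat_mul]
      congr 1
      push_cast
      field_simp
    rw [h1, ENNReal.ofReal_pow (Real.exp_pos _).le]
    gcongr
    exact exp_neg_meanNormPow_le_meanHeat hb _
  have hA1 : P.real A ≤ 1 := measureReal_le_one
  have hMub : M ≤ 1 - c / C * (1 - E) := meanHeat_le hb _ hC0 hkC.le
  have hMlb : Real.exp (-σ * t * c) ≤ M := exp_neg_meanNormPow_le_meanHeat hb _
  have hEM : E < M := by
    refine lt_of_lt_of_le ?_ hMlb
    rw [hE, Real.exp_lt_exp]
    have := mul_lt_mul_of_pos_left hcC (mul_pos hσ ht)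
    linarith
  have hE0 : 0 < E := Real.exp_pos _
  have hE1 : E < 1 := by
    rw [hE, Real.exp_lt_one_iff]
    have := mul_pos (mul_pos hσ ht) hC0
    linarith
  have hkey : E < P.real A * (1 - M + E) := by
    have h1 := exp_neg_lt_exp_neg_mul (mul_pos hσ ht) hc0 hcC
    rw [← neg_mul, ← hE] at h1
    have h2 : 0 ≤ c / C * (1 - E) := mul_nonneg (by positivity) (by linarith)
    calc E < Real.exp (-σ * t * c) * (c / C * (1 - E) + E) := h1
      _ ≤ P.real A * (1 - M + E) := by
          gcongr
          linarith
  -- the probability of ending in `U`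
  have hWlb : (haar p).real U * (L * (M - E)) ≤ P.real W := by
    rw [← rhoProfile_eq hb, Measure.real, Measure.real,
      ← ENNReal.toReal_ofReal (rhoProfile_nonneg hσ hb ht a), ← ENNReal.toReal_mul]
    refine ENNReal.toReal_mono (measure_ne_top _ _) ?_
    rw [hW, hP.measure_X_mem t ht hUm, mul_comm, ← setLIntegral_const]
    exact setLIntegral_mono' hUm fun x hx =>
      ENNReal.ofReal_le_ofReal (rhoProfile_le_re_rho hσ hb ht (hsub hx))
  have hu0 : 0 < (haar p).real U := haar_real_ball_pos _ _
  have hball : P.real {ω | X t ω ∈ ball p a 0} = M := by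
    rw [Measure.real, hP.measure_X_mem t ht (measurableSet_ball _ _), hmass _ ht,
      ENNReal.toReal_ofReal (hE0.trans hEM).le]
  have hjoint := congrArg ENNReal.toReal (hP.measure_supNorm_le_inter hσ hb a t ht hUm hsub)
  have hne1 : haar p (ball p a 0) ≠ ∞ := (haar_ball_lt_top a 0).ne
  have hne2 : haar p U ≠ ∞ := (haar_ball_lt_top _ _).ne
  rw [ENNReal.toReal_add (ENNReal.mul_ne_top hne1 (measure_ne_top _ _))
      (ENNReal.mul_ne_top hne2 (measure_ne_top _ _)),
    ENNReal.toReal_add (ENNReal.mul_ne_top hne1 (measure_ne_top _ _))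
      (ENNReal.mul_ne_top hne2 (measure_ne_top _ _)), ENNReal.toReal_mul, ENNReal.toReal_mul,
    ENNReal.toReal_mul, ENNReal.toReal_mul] at hjoint
  simp only [← measureReal_def] at hjoint
  rw [hball, ← hA, ← hW] at hjoint
  have hjoint' : P.real (A ∩ W) = P.real W - (haar p).real U * L * (M - P.real A) := by
    linear_combination L * hjoint - (P.real (A ∩ W) - P.real W) * hvL
  have hlt : P.real A * P.real W < P.real (A ∩ W) := by
    have h1 := mul_le_mul_of_nonneg_right hWlb (sub_nonneg.2 hA1)
    -- P(A)(1 - M + E) - E equals (M - E)(1 - P(A)) - (M - P(A)): the guaranteed mass in U outweighs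
    -- the loss from paths that leave the ball.
    have h2 := mul_pos (mul_pos hu0 hL0) (sub_pos.2 hkey)
    rw [hjoint']
    linarith
  have hW0 : P W ≠ 0 := by
    have : 0 < P.real W :=
      lt_of_lt_of_le (mul_pos hu0 (mul_pos hL0 (sub_pos.2 hEM))) hWlb
    intro h
    rw [Measure.real, h] at this
    simp at this
  rw [gt_iff_lt, ProbabilityTheory.cond_apply (show MeasurableSet W from measurable_X t hUm), mul_comm, ← div_eq_mul_inv,
    ENNReal.lt_div_iff_mul_lt (Or.inl hW0) (Or.inl (measure_ne_top _ _)), inter_comm,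
    ← ENNReal.toReal_lt_toReal (ENNReal.mul_ne_top (measure_ne_top _ _) (measure_ne_top _ _))
      (measure_ne_top _ _), ENNReal.toReal_mul]
  exact hlt
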